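/- Let $k$ be an algebraically closed field of characteristic zero and let $C$ be a coalgebra over $k$, with dual algebra $C^*=\mathrm{Hom}_k(C,k)$ under the convolution product $(f*g)(c)=\sum f(c_1)g(c_2)$. Assume that $C$ is artinian, i.e. $C$ is artinian both as a left $C^*$-module (action $f\rightharpoonup c=\sum c_1f(c_2)$) and as a right $C^*$-module (action $c\leftharpoonup f=\sum f(c_1)c_2$). A left $C$-comodule $M$ is called quasi-finite if $\mathrm{Hom}_C(K,M)$ is finite-dimensional for every finite-dimensional left $C$-comodule $K$. We say that $C$ satisfies the left $\chi$-condition if, for every quasi-finite left $C$-comodule $M$, every simple left $C$-comodule $S$ and every $i\ge 0$, the space $\mathrm{Ext}^i_C(M,S)$ (computed in the abelian category of left $C$-comodules) is finite-dimensional over $k$. A (left and right) noetherian $k$-algebra $A$ with Jacobson radical $J$ such that $A/J$ is finite-dimensional satisfies the left $\chi$-condition if, for every finitely generated left $A$-module $N$ and every $i\ge 0$, the space $\mathrm{Ext}^i_A(A/J,N)$ (computed in the category of left $A$-modules) is finite-dimensional over $k$. Then $C^*$ is left and right noetherian and $C^*/J(C^*)$ is finite-dimensional, and $C$ satisfies the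 left $\chi$-condition if and only if $C^*$ satisfies the left $\chi$-condition. -/

import Mathlib

open CategoryTheory CategoryTheory.Limits MonoidalCategory TensorProduct

universe u

/-! ### The dual algebra of a coalgebra and artinian coalgebras -/

section Dual

variable (k C : Type u) [Field k] [AddCommGroup C] [Module k C] [Coalgebra k C]

/-- The dual algebra `C*`: linear functionals on `C` with the convolution product
`(f * g)(c) = ∑ f(c₁) g(c₂)` and unit `ε`. -/
abbrev DualAlgebra : Type u := WithConv (C →ₗ[k] k)

/-- `C` as a left `C*`-module: `f ⇀ c = ∑ c₁ f(c₂)`. -/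
@[reducible] noncomputable def leftDualModule : Module (DualAlgebra k C) C where
  smul f c := TensorProduct.rid k C (f.ofConv.lTensor C (Coalgebra.comul c))
  one_smul c := by
    change TensorProduct.rid k C
      ((WithConv.ofConv (1 : DualAlgebra k C)).lTensor C (Coalgebra.comul c)) = c
    have h : WithConv.ofConv (1 : DualAlgebra k C) = Coalgebra.counit := by
      ext x; simp [LinearMap.convOne_def]
    rw [h]; simp
  mul_smul f g c := by
    change TensorProduct.rid k C ((f * g).ofConv.lTensor C (Coalgebra.comul c)) =
      TensorProduct.rid k C (f.ofConv.lTensor C (Coalgebra.comul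
        (TensorProduct.rid k C (g.ofConv.lTensor C (Coalgebra.comul c)))))
    have h1 : ∀ z : C ⊗[k] C,
        f.ofConv.lTensor C (Coalgebra.comul (TensorProduct.rid k C (g.ofConv.lTensor C z))) =
          (TensorProduct.map LinearMap.id ((TensorProduct.rid k k).toLinearMap ∘ₗ
            TensorProduct.map f.ofConv g.ofConv))
            (TensorProduct.assoc k C C C (Coalgebra.comul.rTensor C z)) := by
      intro z
      induction z with
      | zero => simp
      | add x y hx hy => simp only [map_add, hx, hy]
      | tmul a b =>
        simp only [LinearMap.lTensor_tmul, LinearMap.rTensor_tmul, TensorProduct.rid_tmul, map_smul]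
        generalize (Coalgebra.comul (R := k) a) = w
        induction w with
        | zero => simp
        | add x y hx hy => simp only [map_add, smul_add, TensorProduct.add_tmul, hx, hy]
        | tmul x y => simp [TensorProduct.smul_tmul, TensorProduct.smul_tmul', mul_comm]
    rw [h1, Coalgebra.coassoc_apply]
    congr 1
    generalize (Coalgebra.comul (R := k) c) = w
    induction w with
    | zero => simp
    | add x y hx hy => simp only [map_add, hx, hy]
    | tmul x y =>
      simp only [LinearMap.lTensor_tmul, TensorProduct.map_tmul, LinearMap.id_apply]
      congr 1
      change LinearMap.mul' k k (TensorProduct.map f.ofConv g.ofConv (Coalgebra.comul y)) = _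
      generalize (Coalgebra.comul (R := k) y) = w
      induction w with
      | zero => simp
      | add x y hx hy => simp only [map_add, hx, hy]
      | tmul x y => simp [mul_comm]
  smul_zero f := by
    change TensorProduct.rid k C (f.ofConv.lTensor C (Coalgebra.comul 0)) = 0
    simp
  smul_add f c d := by
    change TensorProduct.rid k C (f.ofConv.lTensor C (Coalgebra.comul (c + d))) =
      TensorProduct.rid k C (f.ofConv.lTensor C (Coalgebra.comul c)) +
      TensorProduct.rid k C (f.ofConv.lTensor C (Coalgebra.comul d))
    simp
  add_smul f g c := by
    change TensorProduct.rid k C ((f + g).ofConv.lTensor C (Coalgebra.comul c)) =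
      TensorProduct.rid k C (f.ofConv.lTensor C (Coalgebra.comul c)) +
      TensorProduct.rid k C (g.ofConv.lTensor C (Coalgebra.comul c))
    simp [LinearMap.lTensor_add]
  zero_smul c := by
    change TensorProduct.rid k C
      ((WithConv.ofConv (0 : DualAlgebra k C)).lTensor C (Coalgebra.comul c)) = 0
    simp

/-- `C` as a right `C*`-module: `c ↼ f = ∑ f(c₁) c₂`. -/
@[reducible] noncomputable def rightDualModule : Module (DualAlgebra k C)ᵐᵒᵖ C where
  smul f c := TensorProduct.lid k C (f.unop.ofConv.rTensor C (Coalgebra.comul c))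
  one_smul c := by
    change TensorProduct.lid k C
      ((WithConv.ofConv (1 : DualAlgebra k C)).rTensor C (Coalgebra.comul c)) = c
    have h : WithConv.ofConv (1 : DualAlgebra k C) = Coalgebra.counit := by
      ext x; simp [LinearMap.convOne_def]
    rw [h]; simp
  mul_smul f g c := by
    change TensorProduct.lid k C ((g.unop * f.unop).ofConv.rTensor C (Coalgebra.comul c)) =
      TensorProduct.lid k C (f.unop.ofConv.rTensor C (Coalgebra.comul
        (TensorProduct.lid k C (g.unop.ofConv.rTensor C (Coalgebra.comul c)))))
    generalize f.unop = f
    generalize g.unop = g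
    have h1 : ∀ z : C ⊗[k] C,
        f.ofConv.rTensor C (Coalgebra.comul (TensorProduct.lid k C (g.ofConv.rTensor C z))) =
          (TensorProduct.map ((TensorProduct.lid k k).toLinearMap ∘ₗ
            TensorProduct.map g.ofConv f.ofConv) LinearMap.id)
            ((TensorProduct.assoc k C C C).symm (Coalgebra.comul.lTensor C z)) := by
      intro z
      induction z with
      | zero => simp
      | add x y hx hy => simp only [map_add, hx, hy]
      | tmul a b =>
        simp only [LinearMap.lTensor_tmul, LinearMap.rTensor_tmul, TensorProduct.lid_tmul, map_smul]
        generalize (Coalgebra.comul (R := k) b) = w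
        induction w with
        | zero => simp
        | add x y hx hy => simp only [map_add, smul_add, TensorProduct.tmul_add, hx, hy]
        | tmul x y => simp [TensorProduct.smul_tmul']
    rw [h1, Coalgebra.coassoc_symm_apply]
    congr 1
    generalize (Coalgebra.comul (R := k) c) = w
    induction w with
    | zero => simp
    | add x y hx hy => simp only [map_add, hx, hy]
    | tmul x y =>
      simp only [LinearMap.rTensor_tmul, TensorProduct.map_tmul, LinearMap.id_apply]
      congr 1
  smul_zero f := by
    change TensorProduct.lid k C (f.unop.ofConv.rTensor C (Coalgebra.comul 0)) = 0
    simp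
  smul_add f c d := by
    change TensorProduct.lid k C (f.unop.ofConv.rTensor C (Coalgebra.comul (c + d))) =
      TensorProduct.lid k C (f.unop.ofConv.rTensor C (Coalgebra.comul c)) +
      TensorProduct.lid k C (f.unop.ofConv.rTensor C (Coalgebra.comul d))
    simp
  add_smul f g c := by
    change TensorProduct.lid k C ((f.unop + g.unop).ofConv.rTensor C (Coalgebra.comul c)) =
      TensorProduct.lid k C (f.unop.ofConv.rTensor C (Coalgebra.comul c)) +
      TensorProduct.lid k C (g.unop.ofConv.rTensor C (Coalgebra.comul c))
    simp [LinearMap.rTensor_add]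
  zero_smul c := by
    change TensorProduct.lid k C
      ((WithConv.ofConv (0 : DualAlgebra k C)).rTensor C (Coalgebra.comul c)) = 0
    simp

/-- `C` is artinian (on both sides): it satisfies the descending chain condition on
`C*`-submodules both as a left and as a right `C*`-module. -/
structure IsArtinianCoalgebra : Prop where
  left : @IsArtinian (DualAlgebra k C) C _ _ (leftDualModule k C)
  right : @IsArtinian (DualAlgebra k C)ᵐᵒᵖ C _ _ (rightDualModule k C)

end Dual

/-! ### The abelian category of left comodules -/

section Comodule

variable (k C : Type u) [Field k] [AddCommGroup C] [Module k C] [Coalgebra k C]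

/-- `ε ⊗ 1 : C ⊗ V → k ⊗ V ≅ V`. -/
noncomputable def tensorCounit (V : Type u) [AddCommGroup V] [Module k V] : C ⊗[k] V →ₗ[k] V :=
  (TensorProduct.lid k V).toLinearMap ∘ₗ (Coalgebra.counit (R := k) (A := C)).rTensor V

/-- `Δ ⊗ 1 : C ⊗ V → (C ⊗ C) ⊗ V ≅ C ⊗ (C ⊗ V)`. -/
noncomputable def tensorComul (V : Type u) [AddCommGroup V] [Module k V] :
    C ⊗[k] V →ₗ[k] C ⊗[k] (C ⊗[k] V) :=
  (TensorProduct.assoc k C C V).toLinearMap ∘ₗ (Coalgebra.comul (R := k) (A := C)).rTensor V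

section

variable (V W : Type u) [AddCommGroup V] [Module k V] [AddCommGroup W] [Module k W]

theorem tensorCounit_naturality (f : V →ₗ[k] W) :
    tensorCounit k C W ∘ₗ f.lTensor C = f ∘ₗ tensorCounit k C V := by
  ext c v
  simp [tensorCounit]

theorem tensorComul_naturality (f : V →ₗ[k] W) :
    tensorComul k C W ∘ₗ f.lTensor C = (f.lTensor C).lTensor C ∘ₗ tensorComul k C V := by
  ext c v
  simp only [tensorComul, TensorProduct.AlgebraTensorModule.curry_apply, TensorProduct.curry_apply,
    LinearMap.restrictScalars_self, LinearMap.comp_apply, LinearMap.lTensor_tmul,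
    LinearMap.rTensor_tmul, LinearEquiv.coe_coe]
  generalize (Coalgebra.comul (R := k) c) = w
  induction w with
  | zero => simp
  | add x y hx hy => simp only [map_add, TensorProduct.add_tmul, hx, hy]
  | tmul x y => simp

theorem tensorComul_coassoc :
    (tensorComul k C V).lTensor C ∘ₗ tensorComul k C V =
      tensorComul k C (C ⊗[k] V) ∘ₗ tensorComul k C V := by
  ext c v
  have h1 : ∀ w : C ⊗[k] C, (tensorComul k C V).lTensor C (TensorProduct.assoc k C C V (w ⊗ₜ v)) =
      ((TensorProduct.assoc k C C V).toLinearMap.lTensor C) (TensorProduct.assoc k C (C ⊗[k] C) V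
        ((Coalgebra.comul.lTensor C w) ⊗ₜ v)) := by
    intro w
    induction w with
    | zero => simp
    | add x y hx hy => simp only [map_add, TensorProduct.add_tmul, hx, hy]
    | tmul x y => simp [tensorComul]
  have h2 : ∀ w : C ⊗[k] C, tensorComul k C (C ⊗[k] V) (TensorProduct.assoc k C C V (w ⊗ₜ v)) =
      ((TensorProduct.assoc k C C V).toLinearMap.lTensor C) (TensorProduct.assoc k C (C ⊗[k] C) V
        ((TensorProduct.assoc k C C C (Coalgebra.comul.rTensor C w)) ⊗ₜ v)) := by
    intro w
    induction w with
    | zero => simp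
    | add x y hx hy => simp only [map_add, TensorProduct.add_tmul, hx, hy]
    | tmul x y =>
      simp only [tensorComul, LinearMap.comp_apply, TensorProduct.assoc_tmul,
        LinearMap.rTensor_tmul, LinearEquiv.coe_coe]
      generalize (Coalgebra.comul (R := k) x) = z
      induction z with
      | zero => simp
      | add x y hx hy => simp only [map_add, TensorProduct.add_tmul, hx, hy]
      | tmul x y => simp
  have h3 : tensorComul k C V (c ⊗ₜ v) = TensorProduct.assoc k C C V (Coalgebra.comul c ⊗ₜ v) := rfl
  change (tensorComul k C V).lTensor C (tensorComul k C V (c ⊗ₜ v)) =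
    tensorComul k C (C ⊗[k] V) (tensorComul k C V (c ⊗ₜ v))
  rw [h3, h1, h2, Coalgebra.coassoc_apply]

theorem tensorCounit_comp_tensorComul :
    tensorCounit k C (C ⊗[k] V) ∘ₗ tensorComul k C V = LinearMap.id := by
  ext c v
  have h1 : ∀ w : C ⊗[k] C, tensorCounit k C (C ⊗[k] V) (TensorProduct.assoc k C C V (w ⊗ₜ v)) =
      TensorProduct.lid k C (Coalgebra.counit.rTensor C w) ⊗ₜ v := by
    intro w
    induction w with
    | zero => simp
    | add x y hx hy => simp only [map_add, TensorProduct.add_tmul, hx, hy]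
    | tmul x y => simp [tensorCounit, TensorProduct.smul_tmul']
  change tensorCounit k C (C ⊗[k] V) (TensorProduct.assoc k C C V (Coalgebra.comul c ⊗ₜ v)) = _
  rw [h1]
  simp

theorem lTensor_tensorCounit_comp_tensorComul :
    (tensorCounit k C V).lTensor C ∘ₗ tensorComul k C V = LinearMap.id := by
  ext c v
  have h1 : ∀ w : C ⊗[k] C, (tensorCounit k C V).lTensor C (TensorProduct.assoc k C C V (w ⊗ₜ v)) =
      TensorProduct.rid k C (Coalgebra.counit.lTensor C w) ⊗ₜ v := by
    intro w
    induction w with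
    | zero => simp
    | add x y hx hy => simp only [map_add, TensorProduct.add_tmul, hx, hy]
    | tmul x y => simp [tensorCounit, TensorProduct.smul_tmul]
  change (tensorCounit k C V).lTensor C
    (TensorProduct.assoc k C C V (Coalgebra.comul c ⊗ₜ v)) = _
  rw [h1]
  simp

end

/-- The comonad `V ↦ C ⊗ V` on `k`-vector spaces, with counit `ε ⊗ 1` and
comultiplication `Δ ⊗ 1`. -/
noncomputable def tensorComonad : Comonad (ModuleCat.{u} k) where
  toFunctor := tensorLeft (ModuleCat.of k C)
  ε :=
    { app := fun V => ModuleCat.ofHom (tensorCounit k C V)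
      naturality := fun V W f => ModuleCat.hom_ext (tensorCounit_naturality k C V W f.hom) }
  δ :=
    { app := fun V => ModuleCat.ofHom (tensorComul k C V)
      naturality := fun V W f => ModuleCat.hom_ext (tensorComul_naturality k C V W f.hom) }
  coassoc V := ModuleCat.hom_ext (tensorComul_coassoc k C V)
  left_counit V := ModuleCat.hom_ext (tensorCounit_comp_tensorComul k C V)
  right_counit V := ModuleCat.hom_ext (lTensor_tensorCounit_comp_tensorComul k C V)

instance : (tensorComonad k C).toFunctor.Additive :=
  inferInstanceAs (tensorLeft (ModuleCat.of k C)).Additive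

instance : (tensorComonad k C).toFunctor.Linear k :=
  inferInstanceAs ((tensorLeft (ModuleCat.of k C)).Linear k)

instance : PreservesFiniteLimits (tensorComonad k C).toFunctor :=
  inferInstanceAs (PreservesFiniteLimits (tensorLeft (ModuleCat.of k C)))

/-- The category of left `C`-comodules: an object is a vector space `M = M.A` with a linear
coaction `ρ = M.a : M → C ⊗ M` such that `(ε ⊗ 1) ρ = 1` and `(Δ ⊗ 1) ρ = (1 ⊗ ρ) ρ`; a morphism
`f` is a linear map with `ρ f = (1 ⊗ f) ρ`. -/
abbrev LeftComodule : Type (u + 1) := (tensorComonad k C).Coalgebra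

noncomputable instance : Linear k (LeftComodule k C) where
  homModule M N :=
    { smul := fun r f =>
        { f := r • f.f
          h := by rw [Functor.map_smul, Linear.comp_smul, f.h, Linear.smul_comp] }
      one_smul := fun f => Comonad.Coalgebra.Hom.ext (one_smul k f.f)
      mul_smul := fun r s f => Comonad.Coalgebra.Hom.ext (mul_smul r s f.f)
      smul_zero := fun r => Comonad.Coalgebra.Hom.ext (smul_zero r)
      smul_add := fun r f g => Comonad.Coalgebra.Hom.ext (smul_add r f.f g.f)
      add_smul := fun r s f => Comonad.Coalgebra.Hom.ext (add_smul r s f.f)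
      zero_smul := fun f => Comonad.Coalgebra.Hom.ext (zero_smul k f.f) }
  smul_comp _ _ _ r f g := Comonad.Coalgebra.Hom.ext (Linear.smul_comp _ _ _ r f.f g.f)
  comp_smul _ _ _ f r g := Comonad.Coalgebra.Hom.ext (Linear.comp_smul _ _ _ f.f r g.f)

instance : HasFiniteLimits (LeftComodule k C) where
  out _ _ _ := hasLimitsOfShape_of_hasLimitsOfShape_createsLimitsOfShape
    (Comonad.forget (tensorComonad k C))

instance : HasFiniteColimits (LeftComodule k C) where
  out _ _ _ := hasColimitsOfShape_of_hasColimitsOfShape_createsColimitsOfShape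
    (Comonad.forget (tensorComonad k C))

instance {M N : LeftComodule k C} (f : M ⟶ N) : IsIso (Abelian.coimageImageComparison f) :=
  have := IsIso.of_isIso_fac_right (Abelian.PreservesCoimage.hom_coimageImageComparison
    (Comonad.forget (tensorComonad k C)) f).symm
  isIso_of_reflects_iso _ (Comonad.forget (tensorComonad k C))

noncomputable instance : Abelian (LeftComodule k C) := Abelian.ofCoimageImageComparisonIsIso

instance : HasExt.{u + 1} (LeftComodule k C) := HasExt.standard _

variable {k C} in
/-- A left comodule `M` is quasi-finite if `Hom_C(K, M)` is finite-dimensional for every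
finite-dimensional left comodule `K`. -/
def LeftComodule.IsQuasiFinite (M : LeftComodule k C) : Prop :=
  ∀ K : LeftComodule k C, FiniteDimensional k K.A → FiniteDimensional k (K ⟶ M)

variable {k C} in
/-- The `χ`-condition on a (quasi-finite) left comodule `M`: `Ext_C^i(M, S)`, computed in the
category of left comodules, is finite-dimensional for every simple `S` and every `i ≥ 0`. -/
def LeftComodule.SatisfiesChi (M : LeftComodule k C) : Prop :=
  ∀ S : LeftComodule k C, Simple S → ∀ i : ℕ, FiniteDimensional k (Abelian.Ext M S i)

/-- The left `χ`-condition on the coalgebra `C`. -/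
def Coalgebra.SatisfiesLeftChi : Prop :=
  ∀ M : LeftComodule k C, M.IsQuasiFinite → M.SatisfiesChi

end Comodule

/-! ### The `χ`-condition for algebras -/

section Algebra

variable (k A : Type u) [Field k] [Ring A] [Algebra k A]

/-- The `χ`-condition on a (finitely generated) left `A`-module `M`: `Ext_A^i(A/J, M)` is
finite-dimensional for every `i ≥ 0`, where `J` is the Jacobson radical of `A`. -/
def ModuleCat.SatisfiesChi (M : ModuleCat.{u} A) : Prop :=
  ∀ i : ℕ, FiniteDimensional k (Abelian.Ext (ModuleCat.of A (A ⧸ Ring.jacobson A)) M i)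

/-- The left `χ`-condition on the algebra `A`. -/
def Algebra.SatisfiesLeftChi : Prop :=
  ∀ M : ModuleCat.{u} A, Module.Finite A M → ModuleCat.SatisfiesChi k A M

end Algebra

/-!
A left `C`-comodule is a locally finite right `C*`-module, so a comodule map is injective as soon as
it is injective on the socle. Since a comodule map to `C ⊗ kⁿ` is the same as a linear map to `kⁿ`,
the comodules with finite-dimensional socle are exactly the subcomodules of some `C ⊗ kⁿ`. These are
the artinian comodules, as `C` is artinian, and also the quasi-finite ones, as the socle of `M` is
swept out by the maps to `M` from a single finite-dimensional comodule.

The comodule `C ⊗ kⁿ` is injective and its dual is a free left `C*`-module of rank `n`. Hence the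
exact functor `M ↦ M*` is bijective on maps to artinian comodules, it takes artinian comodules to
the finitely generated left `C*`-modules, and dimension shifting along `0 → X → C ⊗ kⁿ → Y → 0`
gives `Extⁱ(M, X) ≅ Extⁱ(X*, M*)` for artinian `X`.

If `f` vanishes on the socle of `C`, then `1 + g f` acts as the identity on this socle, so it acts
injectively on `C` and has a left inverse. Thus `f` lies in the Jacobson radical `J`, and `C* / J`
is a quotient of the dual of the finite-dimensional socle. The dual of a simple comodule is a simple
module, hence a direct summand of `C* / J`; conversely `C* / J` is the dual of a finite-dimensional
comodule, which is an iterated extension of simple ones. So both `χ`-conditions bound the same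
spaces.
-/

section Socle

variable (R M : Type*) [Ring R] [AddCommGroup M] [Module R M]

/-- The socle of a module: the sum of its simple submodules. -/
def socle : Submodule R M := sSup {N | IsSimpleModule R N}

instance isSemisimpleModule_socle : IsSemisimpleModule R (socle R M) := by
  rw [socle, sSup_eq_iSup]
  exact isSemisimpleModule_biSup_of_isSemisimpleModule_submodule fun N (hN : IsSimpleModule R N) =>
    inferInstance

variable {R M}

theorem le_socle (N : Submodule R M) [hN : IsSimpleModule R N] : N ≤ socle R M :=
  le_sSup hN

theorem map_socle_le {M' : Type*} [AddCommGroup M'] [Module R M'] (p : M →ₗ[R] M') :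
    (socle R M).map p ≤ socle R M' := by
  rw [Submodule.map_le_iff_le_comap]
  refine sSup_le fun N (hN : IsSimpleModule R N) => Submodule.map_le_iff_le_comap.1 ?_
  rcases (p.domRestrict N).injective_or_eq_zero with hp | hp
  · have : IsSimpleModule R (N.map p) := by
      rw [← LinearMap.range_domRestrict]
      exact IsSimpleModule.congr (LinearEquiv.ofInjective _ hp).symm
    exact le_socle _
  · rw [← LinearMap.range_domRestrict, hp, LinearMap.range_zero]
    exact bot_le

theorem finite_socle [IsArtinian R M] : Module.Finite R (socle R M) := by
  have h := IsSemisimpleModule.finite_tfae (R := R) (M := socle R M)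
  exact (h.out 0 2 :).2 inferInstance

end Socle

section LocallyFinite

variable (k R M : Type*) [Field k] [Ring R] [Algebra k R] [AddCommGroup M] [Module k M]
  [Module R M] [IsScalarTower k R M]

/-- An `R`-module over a `k`-algebra `R` is locally finite if its cyclic submodules are
finite-dimensional over `k`. This is the property of comodules, seen as modules over the dual
algebra, which produces simple submodules. -/
def IsLocallyFiniteModule : Prop :=
  ∀ m : M, FiniteDimensional k (Submodule.span R {m})

variable {k R M}

namespace IsLocallyFiniteModule

theorem of_forall_smul_mem
    (h : ∀ m : M, ∃ W : Submodule k M, FiniteDimensional k W ∧ ∀ r : R, r • m ∈ W) :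
    IsLocallyFiniteModule k R M := by
  intro m
  obtain ⟨W, _, hW⟩ := h m
  refine Submodule.finiteDimensional_of_le (S₁ := (Submodule.span R {m}).restrictScalars k)
    (S₂ := W) fun x hx => ?_
  obtain ⟨r, rfl⟩ := Submodule.mem_span_singleton.1 hx
  exact hW r

theorem finiteDimensional_of_fg (hM : IsLocallyFiniteModule k R M) {N : Submodule R M}
    (hN : N.FG) : FiniteDimensional k N := by
  induction N, hN using Submodule.fg_induction with
  | singleton m => exact hM m
  | sup N₁ N₂ _ _ h₁ h₂ =>
    have : FiniteDimensional k (N₁.restrictScalars k) := h₁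
    have : FiniteDimensional k (N₂.restrictScalars k) := h₂
    change FiniteDimensional k ((N₁ ⊔ N₂).restrictScalars k)
    rw [Submodule.restrictScalars_sup]
    exact Submodule.finite_sup (N₁.restrictScalars k) (N₂.restrictScalars k)

theorem exists_isSimpleModule_le (hM : IsLocallyFiniteModule k R M) {N : Submodule R M}
    (hN : N ≠ ⊥) : ∃ S ≤ N, IsSimpleModule R S := by
  obtain ⟨m, hmN, hm⟩ := N.exists_mem_ne_zero_of_ne_bot hN
  have : FiniteDimensional k (Submodule.span R {m}) := hM m
  have : IsArtinian R (Submodule.span R {m}) := isArtinian_of_tower k inferInstance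
  have : Nontrivial (Submodule.span R {m}) :=
    Submodule.nontrivial_iff_ne_bot.2 (by rwa [Ne, Submodule.span_singleton_eq_bot])
  obtain ⟨S, hS⟩ := IsAtomic.exists_atom (Submodule R (Submodule.span R {m}))
  have := isSimpleModule_iff_isAtom.2 hS
  exact ⟨S.map (Submodule.subtype _), (Submodule.map_subtype_le _ _).trans
    ((Submodule.span_singleton_le_iff_mem _ _).2 hmN),
    IsSimpleModule.congr (Submodule.equivSubtypeMap _ S).symm⟩

theorem injective_of_disjoint_socle (hM : IsLocallyFiniteModule k R M) {M' : Type*}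
    [AddCommGroup M'] [Module R M'] (p : M →ₗ[R] M')
    (hp : Disjoint (socle R M) (LinearMap.ker p)) : Function.Injective p := by
  rw [← LinearMap.ker_eq_bot]
  by_contra hker
  obtain ⟨S, hS, hsimple⟩ := hM.exists_isSimpleModule_le hker
  exact (isSimpleModule_iff_isAtom.1 hsimple).1 (le_bot_iff.1 (hp (le_socle S) hS))

theorem finiteDimensional_socle (hM : IsLocallyFiniteModule k R M) [IsArtinian R M] :
    FiniteDimensional k (socle R M) :=
  hM.finiteDimensional_of_fg (Module.Finite.iff_fg.1 finite_socle)

end IsLocallyFiniteModule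

end LocallyFinite

section DualPairing

variable {k C R : Type*} [Field k] [AddCommGroup C] [Module k C] [Ring R] [Module R C]

theorem exists_finset_forall_smul_eq_zero (S : Type*) [Ring S] [Module S C]
    [SMulCommClass R S C] [IsArtinian S C] (I : Set R) :
    ∃ t : Finset R, ↑t ⊆ I ∧ ∀ f ∈ I, ∀ c : C, (∀ g ∈ t, g • c = 0) → f • c = 0 := by
  classical
  let annihilated (f : R) : Submodule S C := LinearMap.ker (Module.toModuleEnd S C f)
  obtain ⟨t, ht⟩ := Finset.exists_inf_le fun f : I => annihilated f
  refine ⟨t.image (↑), by simp, fun f hf c hc => (ht ⟨f, hf⟩ : _ ≤ annihilated f) ?_⟩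
  simp only [Submodule.mem_finsetInf]
  exact fun g hg => hc g (Finset.mem_image_of_mem _ hg)

theorem isNoetherianRing_of_isArtinian_of_dual (S : Type*) [Ring S] [Module S C]
    [SMulCommClass R S C] [IsArtinian S C] [SMulCommClass R k C] (e : R ≃+ Module.Dual k C)
    (he : ∀ f g c, e (g * f) c = e g (f • c)) : IsNoetherianRing R := by
  classical
  refine isNoetherianRing_iff_ideal_fg R |>.2 fun I => ?_
  obtain ⟨t, htI, ht⟩ := exists_finset_forall_smul_eq_zero S (C := C) (I : Set R)
  refine ⟨t, le_antisymm (Ideal.span_le.2 htI) fun f hf => ?_⟩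
  let T : C →ₗ[k] t → C := LinearMap.pi fun g => Module.toModuleEnd k C (g : R)
  have hker : e f ∈ (LinearMap.ker T).dualAnnihilator := by
    rw [Submodule.mem_dualAnnihilator]
    intro c hc
    have : f • c = 0 := ht f hf c fun g hg => congrFun hc ⟨g, hg⟩
    rw [← one_mul f, he, this, map_zero]
  rw [← LinearMap.range_dualMap_eq_dualAnnihilator_ker] at hker
  obtain ⟨ψ, hψ⟩ := hker
  have hf : f = ∑ g : t, e.symm (ψ ∘ₗ LinearMap.single k (fun _ : t => C) g) * g := by
    refine e.injective (LinearMap.ext fun c => ?_)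
    simp only [map_sum, LinearMap.sum_apply, he, AddEquiv.apply_symm_apply, LinearMap.comp_apply,
      LinearMap.coe_single]
    rw [← map_sum, Finset.univ_sum_single, ← hψ]
    rfl
  rw [hf]
  exact sum_mem fun g _ => Ideal.mul_mem_left _ _ (Ideal.subset_span g.2)

end DualPairing

section Contraction

variable {k C V W : Type*} [Field k] [AddCommGroup C] [Module k C] [AddCommGroup V] [Module k V]
  [AddCommGroup W] [Module k W]

variable (V) in
/-- Contraction of the first tensor factor with a linear functional, `c ⊗ v ↦ f(c) v`. It computes
the action of the dual algebra on a left comodule. -/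
noncomputable def contract (f : C →ₗ[k] k) : C ⊗[k] V →ₗ[k] V :=
  (TensorProduct.lid k V).toLinearMap ∘ₗ f.rTensor V

@[simp]
theorem contract_tmul (f : C →ₗ[k] k) (c : C) (v : V) : contract V f (c ⊗ₜ v) = f c • v := by
  simp [contract]

theorem contract_add (f g : C →ₗ[k] k) : contract V (f + g) = contract V f + contract V g := by
  ext; simp [add_smul]

theorem contract_smul (a : k) (f : C →ₗ[k] k) : contract V (a • f) = a • contract V f := by
  ext; simp [mul_smul]

theorem contract_lTensor (p : V →ₗ[k] W) (f : C →ₗ[k] k) (z : C ⊗[k] V) :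
    contract W f (p.lTensor C z) = p (contract V f z) := by
  induction z with
  | zero => simp
  | add x y hx hy => simp only [map_add, hx, hy]
  | tmul c v => simp

theorem exists_finiteDimensional_contract_mem (z : C ⊗[k] V) :
    ∃ U : Submodule k V, FiniteDimensional k U ∧ ∀ f : C →ₗ[k] k, contract V f z ∈ U := by
  induction z with
  | zero => exact ⟨⊥, inferInstance, by simp⟩
  | add x y hx hy =>
    obtain ⟨U, _, hU⟩ := hx
    obtain ⟨U', _, hU'⟩ := hy
    refine ⟨U ⊔ U', inferInstance, fun f => ?_⟩
    rw [map_add]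
    exact add_mem (Submodule.mem_sup_left (hU f)) (Submodule.mem_sup_right (hU' f))
  | tmul c v =>
    refine ⟨k ∙ v, inferInstance, fun f => ?_⟩
    rw [contract_tmul]
    exact Submodule.smul_mem _ _ (Submodule.mem_span_singleton_self v)

theorem eq_of_forall_contract_eq {z z' : C ⊗[k] V}
    (h : ∀ f : C →ₗ[k] k, contract V f z = contract V f z') : z = z' := by
  classical
  let b := Module.Basis.ofVectorSpace k C
  have hcoord (w : C ⊗[k] V) (i) :
      TensorProduct.equivFinsuppOfBasisLeft b w i = contract V (b.coord i) w := by
    induction w with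
    | zero => simp
    | add x y hx hy => simp only [map_add, Finsupp.add_apply, hx, hy]
    | tmul c v => simp
  refine (TensorProduct.equivFinsuppOfBasisLeft b).injective (Finsupp.ext fun i => ?_)
  rw [hcoord, hcoord, h]

theorem mem_range_lTensor_subtype {U : Submodule k V} {z : C ⊗[k] V}
    (h : ∀ f : C →ₗ[k] k, contract V f z ∈ U) : z ∈ LinearMap.range (U.subtype.lTensor C) := by
  refine (lTensor_exact C (LinearMap.exact_subtype_mkQ U) U.mkQ_surjective z).1
    (eq_of_forall_contract_eq fun f => ?_)
  rw [contract_lTensor, map_zero]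
  exact (Submodule.Quotient.mk_eq_zero U).2 (h f)

end Contraction

namespace DualAlgebra

variable {k C : Type u} [Field k] [AddCommGroup C] [Module k C]

theorem ext_apply {c d : C} (h : ∀ f : DualAlgebra k C, f.ofConv c = f.ofConv d) : c = d :=
  Module.eval_apply_injective k (LinearMap.ext fun f => h (WithConv.toConv f))

variable [Coalgebra k C]

attribute [local instance] leftDualModule rightDualModule

theorem apply_smul (f g : DualAlgebra k C) (c : C) : g.ofConv (f • c) = (g * f).ofConv c := by
  change g.ofConv (TensorProduct.rid k C (f.ofConv.lTensor C (Coalgebra.comul c))) =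
    LinearMap.mul' k k (TensorProduct.map g.ofConv f.ofConv (Coalgebra.comul c))
  generalize Coalgebra.comul (R := k) c = z
  induction z with
  | zero => simp
  | add x y hx hy => simp only [map_add, hx, hy]
  | tmul x y => simp [mul_comm]

theorem apply_op_smul (f g : DualAlgebra k C) (c : C) :
    g.ofConv (MulOpposite.op f • c) = (f * g).ofConv c := by
  change g.ofConv (TensorProduct.lid k C (f.ofConv.rTensor C (Coalgebra.comul c))) =
    LinearMap.mul' k k (TensorProduct.map f.ofConv g.ofConv (Coalgebra.comul c))
  generalize Coalgebra.comul (R := k) c = z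
  induction z with
  | zero => simp
  | add x y hx hy => simp only [map_add, hx, hy]
  | tmul x y => simp

instance smulCommClass : SMulCommClass (DualAlgebra k C) (DualAlgebra k C)ᵐᵒᵖ C where
  smul_comm f g c := ext_apply fun h => by
    obtain ⟨g, rfl⟩ := MulOpposite.op_surjective g
    rw [apply_smul, apply_op_smul, apply_op_smul, apply_smul, mul_assoc]

instance isScalarTower : IsScalarTower k (DualAlgebra k C) C where
  smul_assoc a f c := ext_apply fun h => by
    rw [apply_smul, map_smul, apply_smul, mul_smul_comm]; rfl

instance isScalarTower_op : IsScalarTower k (DualAlgebra k C)ᵐᵒᵖ C where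
  smul_assoc a f c := ext_apply fun h => by
    obtain ⟨f, rfl⟩ := MulOpposite.op_surjective f
    rw [← MulOpposite.op_smul, apply_op_smul, map_smul, apply_op_smul, smul_mul_assoc]; rfl

theorem isNoetherianRing [IsArtinian (DualAlgebra k C)ᵐᵒᵖ C] :
    IsNoetherianRing (DualAlgebra k C) :=
  isNoetherianRing_of_isArtinian_of_dual (DualAlgebra k C)ᵐᵒᵖ (WithConv.addEquiv (C →ₗ[k] k))
    fun f g c => (apply_smul f g c).symm

theorem isNoetherianRing_op [IsArtinian (DualAlgebra k C) C] :
    IsNoetherianRing (DualAlgebra k C)ᵐᵒᵖ :=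
  have := SMulCommClass.symm (DualAlgebra k C) (DualAlgebra k C)ᵐᵒᵖ C
  isNoetherianRing_of_isArtinian_of_dual (DualAlgebra k C)
    (MulOpposite.opAddEquiv.symm.trans (WithConv.addEquiv (C →ₗ[k] k)))
    fun f g c => (apply_op_smul f.unop g.unop c).symm

theorem isLocallyFiniteModule : IsLocallyFiniteModule k (DualAlgebra k C)ᵐᵒᵖ C :=
  .of_forall_smul_mem fun c => by
    obtain ⟨U, hU, h⟩ := exists_finiteDimensional_contract_mem (Coalgebra.comul (R := k) c)
    exact ⟨U, hU, fun f => h f.unop.ofConv⟩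

theorem smul_eq_zero_of_mem_socle {f : DualAlgebra k C}
    (hf : ∀ c ∈ socle (DualAlgebra k C)ᵐᵒᵖ C, f.ofConv c = 0) {c : C}
    (hc : c ∈ socle (DualAlgebra k C)ᵐᵒᵖ C) : f • c = 0 :=
  ext_apply fun g => by
    rw [apply_smul, ← apply_op_smul, hf _ (Submodule.smul_mem _ _ hc), map_zero]

theorem exists_mul_eq_one_of_injective_smul {f : DualAlgebra k C}
    (hf : Function.Injective fun c : C => f • c) : ∃ g : DualAlgebra k C, g * f = 1 := by
  obtain ⟨θ, hθ⟩ := LinearMap.dualMap_surjective_of_injective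
    (f := Module.toModuleEnd k C f) hf (WithConv.ofConv 1)
  refine ⟨WithConv.toConv θ, WithConv.ofConv_injective (LinearMap.ext fun c => ?_)⟩
  rw [← apply_smul, ← hθ]
  rfl

theorem mem_jacobson_of_forall_mem_socle {f : DualAlgebra k C}
    (hf : ∀ c ∈ socle (DualAlgebra k C)ᵐᵒᵖ C, f.ofConv c = 0) :
    f ∈ Ring.jacobson (DualAlgebra k C) := by
  rw [← Ideal.jacobson_bot, Ideal.mem_jacobson_iff]
  intro g
  have hinj : Function.Injective fun c : C => (1 + g * f) • c :=
    isLocallyFiniteModule.injective_of_disjoint_socle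
      (Module.toModuleEnd (DualAlgebra k C)ᵐᵒᵖ C (1 + g * f)) <| by
      refine Submodule.disjoint_def.2 fun c hc hker => ?_
      change (1 + g * f) • c = 0 at hker
      rwa [add_smul, mul_smul, smul_eq_zero_of_mem_socle hf hc, smul_zero, add_zero, one_smul]
        at hker
  obtain ⟨h, hh⟩ := exists_mul_eq_one_of_injective_smul hinj
  refine ⟨h, ?_⟩
  rw [Ideal.mem_bot, ← hh]
  noncomm_ring

theorem finiteDimensional_quotient_jacobson [IsArtinian (DualAlgebra k C)ᵐᵒᵖ C] :
    FiniteDimensional k (DualAlgebra k C ⧸ Ring.jacobson (DualAlgebra k C)) := by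
  let D := (socle (DualAlgebra k C)ᵐᵒᵖ C).restrictScalars k
  have : FiniteDimensional k D := isLocallyFiniteModule.finiteDimensional_socle
  let restrict : DualAlgebra k C →ₗ[k] Module.Dual k D :=
    D.subtype.dualMap ∘ₗ (WithConv.linearEquiv k (C →ₗ[k] k)).toLinearMap
  have : FiniteDimensional k (DualAlgebra k C ⧸ LinearMap.ker restrict) :=
    Module.Finite.equiv restrict.quotKerEquivRange.symm
  have hker : LinearMap.ker restrict ≤ (Ring.jacobson (DualAlgebra k C)).restrictScalars k :=
    fun f hf => mem_jacobson_of_forall_mem_socle fun c hc => LinearMap.congr_fun hf ⟨c, hc⟩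
  have := Module.Finite.of_surjective (Submodule.factor hker) (Submodule.factor_surjective hker)
  exact Module.Finite.equiv (Submodule.Quotient.restrictScalarsEquiv k _)

end DualAlgebra

section CoalgebraContraction

variable {k C V : Type u} [Field k] [AddCommGroup C] [Module k C] [Coalgebra k C]
  [AddCommGroup V] [Module k V]

theorem contract_one (z : C ⊗[k] V) :
    contract V (1 : DualAlgebra k C).ofConv z = tensorCounit k C V z := by
  induction z with
  | zero => simp
  | add x y hx hy => simp only [map_add, hx, hy]
  | tmul c v => simp [tensorCounit, LinearMap.convOne_def]

theorem contract_mul (f g : DualAlgebra k C) (z : C ⊗[k] V) :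
    contract V (f * g).ofConv z =
      contract V g.ofConv (contract (C ⊗[k] V) f.ofConv (tensorComul k C V z)) := by
  induction z with
  | zero => simp
  | add x y hx hy => simp only [map_add, hx, hy]
  | tmul c v =>
    rw [contract_tmul]
    change LinearMap.mul' k k (TensorProduct.map f.ofConv g.ofConv (Coalgebra.comul c)) • v =
      contract V g.ofConv (contract (C ⊗[k] V) f.ofConv
        (TensorProduct.assoc k C C V (Coalgebra.comul c ⊗ₜ v)))
    generalize Coalgebra.comul (R := k) c = w
    induction w with
    | zero => simp
    | add x y hx hy => simp only [map_add, add_smul, TensorProduct.add_tmul, hx, hy]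
    | tmul x y => simp [mul_smul]

end CoalgebraContraction

namespace LeftComodule

variable {k C : Type u} [Field k] [AddCommGroup C] [Module k C] [Coalgebra k C]

/-- The coaction of a left comodule as a linear map. -/
noncomputable def coaction (M : LeftComodule k C) : M.A →ₗ[k] C ⊗[k] M.A := M.a.hom

theorem tensorCounit_coaction (M : LeftComodule k C) (m : M.A) :
    tensorCounit k C M.A (M.coaction m) = m :=
  LinearMap.congr_fun (congrArg ModuleCat.Hom.hom M.counit) m

theorem tensorComul_coaction (M : LeftComodule k C) (m : M.A) :
    tensorComul k C M.A (M.coaction m) = M.coaction.lTensor C (M.coaction m) :=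
  LinearMap.congr_fun (congrArg ModuleCat.Hom.hom M.coassoc) m

theorem coaction_hom_apply {M N : LeftComodule k C} (φ : M ⟶ N) (m : M.A) :
    N.coaction (φ.f.hom m) = φ.f.hom.lTensor C (M.coaction m) :=
  (LinearMap.congr_fun (congrArg ModuleCat.Hom.hom φ.h) m).symm

/-- The right module structure `m f = ∑ f(m₋₁) m₀` of a left comodule over the dual algebra. -/
noncomputable instance dualAlgebraModule (M : LeftComodule k C) :
    Module (DualAlgebra k C)ᵐᵒᵖ M.A where
  smul f m := contract M.A f.unop.ofConv (M.coaction m)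
  one_smul m := (contract_one _).trans (M.tensorCounit_coaction m)
  mul_smul f g m := by
    change contract M.A (g.unop * f.unop).ofConv (M.coaction m) =
      contract M.A f.unop.ofConv (M.coaction (contract M.A g.unop.ofConv (M.coaction m)))
    rw [contract_mul, tensorComul_coaction, contract_lTensor]
  smul_zero f := by
    change contract M.A f.unop.ofConv (M.coaction 0) = 0
    rw [map_zero, map_zero]
  smul_add f m n := by
    change contract M.A f.unop.ofConv (M.coaction (m + n)) = _
    rw [map_add, map_add]; rfl
  add_smul f g m := LinearMap.congr_fun (contract_add f.unop.ofConv g.unop.ofConv) _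
  zero_smul m := by
    change contract M.A (0 : C →ₗ[k] k) (M.coaction m) = 0
    rw [← zero_smul k 0, contract_smul, zero_smul, LinearMap.zero_apply]

theorem op_smul_def (M : LeftComodule k C) (f : DualAlgebra k C) (m : M.A) :
    MulOpposite.op f • m = contract M.A f.ofConv (M.coaction m) := rfl

instance isScalarTower (M : LeftComodule k C) : IsScalarTower k (DualAlgebra k C)ᵐᵒᵖ M.A where
  smul_assoc r f _ := LinearMap.congr_fun (contract_smul r f.unop.ofConv) _

theorem isLocallyFiniteModule (M : LeftComodule k C) :
    IsLocallyFiniteModule k (DualAlgebra k C)ᵐᵒᵖ M.A :=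
  .of_forall_smul_mem fun m => by
    obtain ⟨U, hU, h⟩ := exists_finiteDimensional_contract_mem (M.coaction m)
    exact ⟨U, hU, fun f => h f.unop.ofConv⟩

/-- A comodule from a right module over the dual algebra whose action comes from a coaction. -/
noncomputable def ofModule (V : Type u) [AddCommGroup V] [Module k V]
    [Module (DualAlgebra k C)ᵐᵒᵖ V] (ρ : V →ₗ[k] C ⊗[k] V)
    (hρ : ∀ (f : DualAlgebra k C) v, contract V f.ofConv (ρ v) = MulOpposite.op f • v) :
    LeftComodule k C where
  A := ModuleCat.of k V
  a := ModuleCat.ofHom (Y := C ⊗[k] V) ρ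
  counit := ModuleCat.hom_ext <| LinearMap.ext fun v => by
    change tensorCounit k C V (ρ v) = v
    rw [← contract_one, hρ, MulOpposite.op_one, one_smul]
  coassoc := ModuleCat.hom_ext <| LinearMap.ext fun v => by
    change tensorComul k C V (ρ v) = ρ.lTensor C (ρ v)
    refine eq_of_forall_contract_eq fun f => eq_of_forall_contract_eq fun g => ?_
    rw [← contract_mul (WithConv.toConv f) (WithConv.toConv g), contract_lTensor,
      hρ (WithConv.toConv f), hρ (WithConv.toConv g), hρ, MulOpposite.op_mul, mul_smul]

/-- Comodule morphisms are linear over the dual algebra. -/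
noncomputable def toLinear {M N : LeftComodule k C} (φ : M ⟶ N) :
    M.A →ₗ[(DualAlgebra k C)ᵐᵒᵖ] N.A where
  toFun := φ.f.hom
  map_add' := map_add _
  map_smul' f m := by
    obtain ⟨f, rfl⟩ := MulOpposite.op_surjective f
    rw [RingHom.id_apply, op_smul_def, op_smul_def, coaction_hom_apply, contract_lTensor]

/-- Maps linear over the dual algebra are comodule morphisms. -/
noncomputable def ofLinear {M N : LeftComodule k C} (p : M.A →ₗ[(DualAlgebra k C)ᵐᵒᵖ] N.A) :
    M ⟶ N where
  f := ModuleCat.ofHom (p.restrictScalars k)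
  h := ModuleCat.hom_ext <| LinearMap.ext fun m => eq_of_forall_contract_eq fun f => by
    change contract N.A f ((p.restrictScalars k).lTensor C (M.coaction m)) = _
    rw [contract_lTensor]
    exact p.map_smul (MulOpposite.op (WithConv.toConv f)) m

@[simp]
theorem toLinear_apply {M N : LeftComodule k C} (φ : M ⟶ N) (m : M.A) :
    toLinear φ m = φ.f.hom m := rfl

theorem exists_restrict_coaction (M : LeftComodule k C)
    (N : Submodule (DualAlgebra k C)ᵐᵒᵖ M.A) :
    ∃ ρ : N.restrictScalars k →ₗ[k] C ⊗[k] N.restrictScalars k, ∀ (f : DualAlgebra k C) n,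
      contract (N.restrictScalars k) f.ofConv (ρ n) = MulOpposite.op f • n := by
  let ι := (N.restrictScalars k).subtype
  have hι : Function.Injective (ι.lTensor C) :=
    Module.Flat.lTensor_preserves_injective_linearMap ι (Submodule.subtype_injective _)
  have hmem (n : N.restrictScalars k) : M.coaction n ∈ LinearMap.range (ι.lTensor C) :=
    mem_range_lTensor_subtype fun f => N.smul_mem (MulOpposite.op (WithConv.toConv f)) n.2
  let ρ := (LinearEquiv.ofInjective _ hι).symm.toLinearMap ∘ₗ (M.coaction ∘ₗ ι).codRestrict _ hmem
  have hρ (n) : ι.lTensor C (ρ n) = M.coaction n :=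
    LinearEquiv.ofInjective_symm_apply (h := hι) _ _
  refine ⟨ρ, fun f n => Subtype.ext ?_⟩
  change ι (contract _ f.ofConv (ρ n)) = MulOpposite.op f • (n : M.A)
  rw [← contract_lTensor, hρ, op_smul_def]

theorem exists_subcomodule (M : LeftComodule k C) (N : Submodule (DualAlgebra k C)ᵐᵒᵖ M.A) :
    ∃ K : LeftComodule k C, Nonempty (K.A ≃ₗ[(DualAlgebra k C)ᵐᵒᵖ] N) := by
  obtain ⟨ρ, hρ⟩ := M.exists_restrict_coaction N
  let e : (ofModule (N.restrictScalars k) ρ hρ).A ≃ₗ[(DualAlgebra k C)ᵐᵒᵖ] N.restrictScalars k :=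
    { AddEquiv.refl (N.restrictScalars k) with
      map_smul' := fun f n => hρ f.unop n }
  exact ⟨_, ⟨e.trans (Submodule.restrictScalarsEquiv k _ _ N)⟩⟩

section Dual

/-- The left module structure `(f h)(m) = h(m f)` over the dual algebra on the dual of a left
comodule. -/
noncomputable instance dualModule (M : LeftComodule k C) :
    Module (DualAlgebra k C) (Module.Dual k M.A) where
  smul f h := h ∘ₗ contract M.A f.ofConv ∘ₗ M.coaction
  one_smul h := LinearMap.ext fun m => congrArg h (one_smul (DualAlgebra k C)ᵐᵒᵖ m)
  mul_smul f g h := LinearMap.ext fun m =>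
    congrArg h (mul_smul (MulOpposite.op g) (MulOpposite.op f) m)
  smul_zero _ := LinearMap.zero_comp _
  smul_add _ _ _ := LinearMap.add_comp _ _ _
  add_smul f g h := LinearMap.ext fun m =>
    (congrArg h (add_smul (MulOpposite.op f) (MulOpposite.op g) m)).trans (map_add h _ _)
  zero_smul h := LinearMap.ext fun m =>
    (congrArg h (zero_smul (DualAlgebra k C)ᵐᵒᵖ m)).trans (map_zero h)

theorem dual_smul_apply {M : LeftComodule k C} (f : DualAlgebra k C) (h : Module.Dual k M.A)
    (m : M.A) : (f • h) m = h (MulOpposite.op f • m) := rfl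

theorem isScalarTower_dual (M : LeftComodule k C) :
    IsScalarTower k (DualAlgebra k C) (Module.Dual k M.A) :=
  ⟨fun r f h => LinearMap.ext fun m => by
    rw [dual_smul_apply, MulOpposite.op_smul, smul_assoc, map_smul]
    rfl⟩

/-- The dual of a left comodule as a left module over the dual algebra. -/
noncomputable abbrev dual (M : LeftComodule k C) : ModuleCat.{u} (DualAlgebra k C) :=
  ModuleCat.of (DualAlgebra k C) (Module.Dual k M.A)

/-- The transpose of a comodule morphism. -/
noncomputable def dualMap {M N : LeftComodule k C} (φ : M ⟶ N) : N.dual ⟶ M.dual :=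
  ModuleCat.ofHom
    { toFun := φ.f.hom.dualMap
      map_add' := map_add _
      map_smul' := fun f h => LinearMap.ext fun m =>
        (congrArg h ((toLinear φ).map_smul (MulOpposite.op f) m)).symm }

variable (k C) in
/-- The contravariant duality functor from left comodules to left modules over the dual algebra. -/
noncomputable def dualFunctor : (LeftComodule k C)ᵒᵖ ⥤ ModuleCat.{u} (DualAlgebra k C) where
  obj M := M.unop.dual
  map φ := dualMap φ.unop

instance additive_dualFunctor : (dualFunctor k C).Additive where
  map_add := ModuleCat.hom_ext (LinearMap.ext fun _ => LinearMap.comp_add _ _ _)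

theorem dualMap_smul {M N : LeftComodule k C} (r : k) (φ : M ⟶ N) :
    dualMap (r • φ) = r • dualMap φ :=
  have := M.isScalarTower_dual
  ModuleCat.hom_ext <| LinearMap.ext fun h =>
    (LinearMap.comp_smul (M := M.A) h r φ.f.hom).trans (algebraMap_smul (DualAlgebra k C) r _).symm

theorem dualMap_injective {M N : LeftComodule k C} :
    Function.Injective (dualMap : (M ⟶ N) → (N.dual ⟶ M.dual)) := fun _ _ h =>
  Comonad.Coalgebra.Hom.ext <| ModuleCat.hom_ext <| LinearMap.ext fun m =>
    Module.eval_apply_injective k <| LinearMap.ext fun χ =>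
      LinearMap.congr_fun (LinearMap.congr_fun (congrArg ModuleCat.Hom.hom h) χ) m

end Dual

section Exactness

theorem mono_iff_injective {M N : LeftComodule k C} (φ : M ⟶ N) :
    Mono φ ↔ Function.Injective φ.f.hom := by
  rw [← ModuleCat.mono_iff_injective]
  exact ((Comonad.forget (tensorComonad k C)).mono_map_iff_mono φ).symm

theorem epi_iff_surjective {M N : LeftComodule k C} (φ : M ⟶ N) :
    Epi φ ↔ Function.Surjective φ.f.hom := by
  rw [← ModuleCat.epi_iff_surjective]
  exact ((Comonad.forget (tensorComonad k C)).epi_map_iff_epi φ).symm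

theorem function_exact {S : ShortComplex (LeftComodule k C)} (hS : S.Exact) :
    Function.Exact S.f.f.hom S.g.f.hom :=
  have : (Comonad.forget (tensorComonad k C)).PreservesZeroMorphisms := ⟨fun _ _ => rfl⟩
  have : PreservesFiniteLimits (Comonad.forget (tensorComonad k C)) :=
    ⟨fun _ _ _ => inferInstance⟩
  (ShortComplex.ShortExact.moduleCat_exact_iff_function_exact _).1
    (hS.map (Comonad.forget (tensorComonad k C)))

theorem function_exact_dualMap {S : ShortComplex (LeftComodule k C)} (hS : S.Exact) :
    Function.Exact (dualMap S.g).hom (dualMap S.f).hom :=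
  have h : LinearMap.ker S.f.f.hom.dualMap = LinearMap.range S.g.f.hom.dualMap := by
    rw [LinearMap.ker_dualMap_eq_dualAnnihilator_range,
      LinearMap.range_dualMap_eq_dualAnnihilator_ker, LinearMap.exact_iff.1 (function_exact hS)]
  fun χ => SetLike.ext_iff.1 h χ

theorem surjective_dualMap {M N : LeftComodule k C} (φ : M ⟶ N) [Mono φ] :
    Function.Surjective (dualMap φ).hom :=
  LinearMap.dualMap_surjective_of_injective ((mono_iff_injective φ).1 inferInstance)

theorem injective_dualMap {M N : LeftComodule k C} (φ : M ⟶ N) [Epi φ] :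
    Function.Injective (dualMap φ).hom :=
  LinearMap.dualMap_injective_of_surjective ((epi_iff_surjective φ).1 inferInstance)

theorem shortExact_dualFunctor {S : ShortComplex (LeftComodule k C)} (hS : S.ShortExact) :
    (S.op.map (dualFunctor k C)).ShortExact :=
  have := hS.mono_f
  have := hS.epi_g
  { exact := (ShortComplex.ShortExact.moduleCat_exact_iff_function_exact _).2
      (function_exact_dualMap hS.exact)
    mono_f := (ModuleCat.mono_iff_injective _).2 (injective_dualMap S.g)
    epi_g := (ModuleCat.epi_iff_surjective _).2 (surjective_dualMap S.f) }

end Exactness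

section Cofree

variable {M : LeftComodule k C} {V : Type u} [AddCommGroup V] [Module k V]

variable (k C V) in
/-- The cofree comodule `C ⊗ V` on a vector space `V`. -/
noncomputable abbrev cofree : LeftComodule k C :=
  (tensorComonad k C).cofree.obj (ModuleCat.of k V)

instance injective_cofree : Injective (cofree k C V) :=
  have := Module.injective_of_isSemisimpleRing k V
  have := Module.injective_object_of_injective_module k V
  Injective.injective_of_adjoint (tensorComonad k C).adj (ModuleCat.of k V)

/-- The universal property of the cofree comodule. -/
noncomputable def homCofreeEquiv : (M ⟶ cofree k C V) ≃ₗ[k] M.A →ₗ[k] V where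
  toFun φ := tensorCounit k C V ∘ₗ φ.f.hom
  invFun h := (tensorComonad k C).adj.homEquiv M (ModuleCat.of k V) (ModuleCat.ofHom h)
  left_inv φ := ((tensorComonad k C).adj.homEquiv M (ModuleCat.of k V)).apply_symm_apply φ
  right_inv h := congrArg ModuleCat.Hom.hom <|
    ((tensorComonad k C).adj.homEquiv M (ModuleCat.of k V)).symm_apply_apply (ModuleCat.ofHom h)
  map_add' _ _ := LinearMap.comp_add _ _ _
  map_smul' _ _ := LinearMap.comp_smul _ _ _

theorem tensorCounit_homCofreeEquiv_symm (h : M.A →ₗ[k] V) (m : M.A) :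
    tensorCounit k C V (((homCofreeEquiv (C := C)).symm h).f.hom m) = h m :=
  LinearMap.congr_fun (homCofreeEquiv.apply_symm_apply h) m

theorem exists_mono_cofree_of_finiteDimensional_socle (M : LeftComodule k C)
    [hM : FiniteDimensional k (socle (DualAlgebra k C)ᵐᵒᵖ M.A)] :
    ∃ (n : ℕ) (ι : M ⟶ cofree k C (Fin n → k)), Mono ι := by
  let D := (socle (DualAlgebra k C)ᵐᵒᵖ M.A).restrictScalars k
  have : FiniteDimensional k D := hM
  obtain ⟨retraction, hretraction⟩ := D.subtype.exists_leftInverse_of_injective D.ker_subtype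
  let coord : M.A →ₗ[k] Fin (Module.finrank k D) → k :=
    (Module.finBasis k D).equivFun.toLinearMap ∘ₗ retraction
  refine ⟨_, homCofreeEquiv.symm coord, (mono_iff_injective _).2 <|
    M.isLocallyFiniteModule.injective_of_disjoint_socle (toLinear (homCofreeEquiv.symm coord)) <|
      Submodule.disjoint_def.2 fun m hm hker => ?_⟩
  have hcoord : coord m = 0 := by
    rw [← tensorCounit_homCofreeEquiv_symm (C := C) coord m, ← toLinear_apply,
      LinearMap.mem_ker.1 hker]
    exact map_zero (tensorCounit k C _)
  have hretr : retraction m = 0 := (Module.finBasis k D).equivFun.map_eq_zero_iff.1 hcoord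
  exact congrArg Subtype.val ((LinearMap.congr_fun hretraction ⟨m, hm⟩).symm.trans hretr)

theorem exists_mono_cofree (M : LeftComodule k C) [IsArtinian (DualAlgebra k C)ᵐᵒᵖ M.A] :
    ∃ (n : ℕ) (ι : M ⟶ cofree k C (Fin n → k)), Mono ι :=
  have := M.isLocallyFiniteModule.finiteDimensional_socle
  M.exists_mono_cofree_of_finiteDimensional_socle

attribute [local instance] rightDualModule

theorem contract_tensorComul_tmul (f : DualAlgebra k C) (c : C) (v : V) :
    contract (C ⊗[k] V) f.ofConv (tensorComul k C V (c ⊗ₜ v)) =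
      (MulOpposite.op f • c) ⊗ₜ[k] v := by
  change contract (C ⊗[k] V) f.ofConv (TensorProduct.assoc k C C V (Coalgebra.comul c ⊗ₜ v)) =
    TensorProduct.lid k C (f.ofConv.rTensor C (Coalgebra.comul c)) ⊗ₜ v
  generalize Coalgebra.comul (R := k) c = w
  induction w with
  | zero => simp
  | add x y hx hy => simp only [map_add, TensorProduct.add_tmul, hx, hy]
  | tmul x y => simp [TensorProduct.smul_tmul']

/-- A cofree comodule of finite rank is a finite power of `C`. -/
noncomputable def cofreeEquiv (n : ℕ) :
    (cofree k C (Fin n → k)).A ≃ₗ[(DualAlgebra k C)ᵐᵒᵖ] (Fin n → C) where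
  __ := (TensorProduct.piScalarRight k k C (Fin n)).toAddEquiv
  map_smul' f z := by
    obtain ⟨f, rfl⟩ := MulOpposite.op_surjective f
    change TensorProduct.piScalarRight k k C (Fin n)
        (contract (C ⊗[k] (Fin n → k)) f.ofConv (tensorComul k C (Fin n → k) z)) =
      MulOpposite.op f • TensorProduct.piScalarRight k k C (Fin n) z
    refine TensorProduct.induction_on (M := C) (N := Fin n → k) z ?_ (fun c v => ?_)
      fun x y hx hy => ?_
    · simp only [map_zero, smul_zero]
    · rw [contract_tensorComul_tmul]
      ext i
      simp [smul_comm (v i)]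
    · rw [map_add, map_add, map_add, map_add, hx, hy]
      exact (smul_add (A := Fin n → C) (MulOpposite.op f) _ _).symm

theorem isArtinian_cofree [IsArtinian (DualAlgebra k C)ᵐᵒᵖ C] (n : ℕ) :
    IsArtinian (DualAlgebra k C)ᵐᵒᵖ (cofree k C (Fin n → k)).A :=
  isArtinian_of_linearEquiv (cofreeEquiv n).symm

/-- The dual of a cofree comodule of finite rank is free. -/
noncomputable def dualCofreeEquiv (n : ℕ) :
    (Fin n → DualAlgebra k C) ≃ₗ[DualAlgebra k C] Module.Dual k (cofree k C (Fin n → k)).A where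
  __ := (AddEquiv.piCongrRight fun _ => WithConv.addEquiv _).trans
    (LinearMap.lsum k (fun _ => C) k ≪≫ₗ
      (TensorProduct.piScalarRight k k C (Fin n)).dualMap).toAddEquiv
  map_smul' f F := by
    refine TensorProduct.ext' (M := C) (N := Fin n → k) fun c v => ?_
    let coord := TensorProduct.piScalarRight k k C (Fin n)
    change LinearMap.lsum k (fun _ => C) k (fun i => (f * F i).ofConv) (coord (c ⊗ₜ v)) =
      LinearMap.lsum k (fun _ => C) k (fun i => (F i).ofConv)
        (coord (contract (C ⊗[k] (Fin n → k)) f.ofConv (tensorComul k C (Fin n → k) (c ⊗ₜ v))))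
    rw [contract_tensorComul_tmul]
    simp [coord, DualAlgebra.apply_op_smul]

variable (k C) in
/-- The coordinate functionals `c ⊗ v ↦ ε(c) vᵢ` form a basis of the dual of `C ⊗ kⁿ`. -/
noncomputable def dualCofreeBasis (n : ℕ) :
    Module.Basis (Fin n) (DualAlgebra k C) (cofree k C (Fin n → k)).dual :=
  .ofEquivFun (dualCofreeEquiv n).symm

theorem dualCofreeBasis_apply {n : ℕ} (i : Fin n) :
    dualCofreeBasis k C n i = LinearMap.proj i ∘ₗ tensorCounit k C (Fin n → k) := by
  refine TensorProduct.ext' (M := C) (N := Fin n → k) fun c v => ?_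
  rw [dualCofreeBasis, Module.Basis.coe_ofEquivFun]
  change LinearMap.lsum k (fun _ => C) k
      (fun j => ((Pi.single i 1 : Fin n → DualAlgebra k C) j).ofConv)
      (TensorProduct.piScalarRight k k C (Fin n) (c ⊗ₜ v)) =
    tensorCounit k C (Fin n → k) (c ⊗ₜ v) i
  simp [tensorCounit, Pi.single_apply, LinearMap.convOne_def, apply_ite, ite_apply, mul_comm]

end Cofree

section Duality

variable {M X : LeftComodule k C}

theorem isArtinian_of_mono (φ : M ⟶ X) [Mono φ] [IsArtinian (DualAlgebra k C)ᵐᵒᵖ X.A] :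
    IsArtinian (DualAlgebra k C)ᵐᵒᵖ M.A :=
  isArtinian_of_injective (toLinear φ) ((mono_iff_injective φ).1 inferInstance)

theorem isArtinian_of_epi (φ : M ⟶ X) [Epi φ] [IsArtinian (DualAlgebra k C)ᵐᵒᵖ M.A] :
    IsArtinian (DualAlgebra k C)ᵐᵒᵖ X.A :=
  isArtinian_of_surjective M.A (toLinear φ) ((epi_iff_surjective φ).1 inferInstance)

theorem exists_dualMap_eq_of_cofree {n : ℕ} (φ : (cofree k C (Fin n → k)).dual ⟶ M.dual) :
    ∃ ψ : M ⟶ cofree k C (Fin n → k), dualMap ψ = φ := by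
  let h : M.A →ₗ[k] Fin n → k := LinearMap.pi fun i => φ.hom (dualCofreeBasis k C n i)
  let ψ : M ⟶ cofree k C (Fin n → k) := homCofreeEquiv.symm h
  refine ⟨ψ, ModuleCat.hom_ext <| (dualCofreeBasis k C n).ext fun i => LinearMap.ext fun m => ?_⟩
  change dualCofreeBasis k C n i (ψ.f.hom m) = h m i
  rw [dualCofreeBasis_apply, ← tensorCounit_homCofreeEquiv_symm (C := C) h m]
  rfl

theorem dualMap_surjective [IsArtinian (DualAlgebra k C)ᵐᵒᵖ X.A] :
    Function.Surjective (dualMap : (M ⟶ X) → (X.dual ⟶ M.dual)) := by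
  intro φ
  obtain ⟨n, ι, _⟩ := X.exists_mono_cofree
  obtain ⟨ψ, hψ⟩ := exists_dualMap_eq_of_cofree (dualMap ι ≫ φ)
  have hzero : ψ ≫ cokernel.π ι = 0 := dualMap_injective <| by
    have hmap {A B D : LeftComodule k C} (a : A ⟶ B) (b : B ⟶ D) :
        dualMap (a ≫ b) = dualMap b ≫ dualMap a := rfl
    have hmap_zero (A B : LeftComodule k C) : dualMap (0 : A ⟶ B) = 0 :=
      (dualFunctor k C).map_zero _ _
    rw [hmap, hψ, ← Category.assoc, ← hmap, cokernel.condition, hmap_zero, hmap_zero, zero_comp]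
  have hexact := ShortComplex.exact_cokernel ι
  have : Mono (ShortComplex.mk ι (cokernel.π ι) (cokernel.condition ι)).f := ‹Mono ι›
  have : Epi (dualMap ι) := (ModuleCat.epi_iff_surjective _).2 (surjective_dualMap ι)
  refine ⟨hexact.lift ψ hzero, (cancel_epi (dualMap ι)).1 ?_⟩
  exact (congrArg dualMap (hexact.lift_f ψ hzero)).trans hψ

variable (M X) in
/-- Transposition as an isomorphism of Hom spaces. -/
noncomputable def dualMapEquiv [IsArtinian (DualAlgebra k C)ᵐᵒᵖ X.A] :
    (M ⟶ X) ≃ₗ[k] (X.dual ⟶ M.dual) :=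
  .ofBijective
    { toFun := dualMap
      map_add' := fun _ _ => (dualFunctor k C).map_add
      map_smul' := dualMap_smul } ⟨dualMap_injective, dualMap_surjective⟩

instance projective_dual_cofree (n : ℕ) : Projective (cofree k C (Fin n → k)).dual :=
  have := Module.Projective.of_basis (dualCofreeBasis k C n)
  (IsProjective.iff_projective _).1 this

theorem finite_dual [IsArtinian (DualAlgebra k C)ᵐᵒᵖ X.A] :
    Module.Finite (DualAlgebra k C) X.dual := by
  obtain ⟨n, ι, _⟩ := X.exists_mono_cofree
  have := Module.Finite.of_basis (dualCofreeBasis k C n)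
  exact Module.Finite.of_surjective (dualMap ι).hom (surjective_dualMap ι)

end Duality

attribute [local instance] rightDualModule

theorem exists_surjective_dual_cofree (N : Type u) [AddCommGroup N] [Module (DualAlgebra k C) N]
    [Module.Finite (DualAlgebra k C) N] :
    ∃ (n : ℕ) (q : (cofree k C (Fin n → k)).dual →ₗ[DualAlgebra k C] N), Function.Surjective q := by
  obtain ⟨n, p, hp⟩ := Module.Finite.exists_fin' (DualAlgebra k C) N
  exact ⟨n, p ∘ₗ (dualCofreeBasis k C n).equivFun.toLinearMap, hp.comp (LinearEquiv.surjective _)⟩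

theorem exists_artinian_dual_equiv [IsArtinian (DualAlgebra k C)ᵐᵒᵖ C] (N : Type u)
    [AddCommGroup N] [Module (DualAlgebra k C) N] [Module.Finite (DualAlgebra k C) N] :
    ∃ M : LeftComodule k C, IsArtinian (DualAlgebra k C)ᵐᵒᵖ M.A ∧
      Nonempty (M.dual ≃ₗ[DualAlgebra k C] N) := by
  obtain ⟨n, q, hq⟩ := exists_surjective_dual_cofree (k := k) (C := C) N
  have := Module.Finite.of_basis (dualCofreeBasis k C n)
  have := DualAlgebra.isNoetherianRing (k := k) (C := C)
  have := isNoetherian_of_isNoetherianRing_of_finite (DualAlgebra k C)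
    (cofree k C (Fin n → k)).dual
  obtain ⟨m, r, hr⟩ := exists_surjective_dual_cofree (k := k) (C := C) (LinearMap.ker q)
  obtain ⟨ψ, hψ⟩ := exists_dualMap_eq_of_cofree (ModuleCat.ofHom ((LinearMap.ker q).subtype ∘ₗ r))
  have hker : LinearMap.ker (dualMap (kernel.ι ψ)).hom = LinearMap.ker q := by
    rw [LinearMap.exact_iff.1 (function_exact_dualMap (ShortComplex.exact_kernel ψ)), hψ,
      ModuleCat.hom_ofHom, LinearMap.range_comp_of_range_eq_top _ (LinearMap.range_eq_top.2 hr),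
      Submodule.range_subtype]
  have := isArtinian_cofree (k := k) (C := C) n
  exact ⟨kernel ψ, isArtinian_of_mono (kernel.ι ψ),
    ⟨((LinearMap.quotKerEquivOfSurjective _ (surjective_dualMap (kernel.ι ψ))).symm.trans
      (Submodule.quotEquivOfEq _ _ hker)).trans (LinearMap.quotKerEquivOfSurjective q hq)⟩⟩

end LeftComodule

section DimensionShift

universe w v t s w' v' t'

open Abelian

variable (R : Type s) [CommRing R] {A : Type t} [Category.{v} A] [Abelian A] [HasExt.{w} A]
  [Linear R A]

theorem nonempty_quotient_equiv_ext_succ_of_injective {S : ShortComplex A}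
    (hS : S.ShortExact) [Injective S.X₂] (M : A) (n : ℕ) :
    Nonempty ((Ext M S.X₃ n ⧸ LinearMap.range
      ((Ext.mk₀ S.g).postcompOfLinear R M (add_zero n))) ≃ₗ[R] Ext M S.X₁ (n + 1)) := by
  let δ : Ext M S.X₃ n →ₗ[R] Ext M S.X₁ (n + 1) := hS.extClass.postcompOfLinear R M rfl
  have hδ : Function.Surjective δ := fun x =>
    Ext.covariant_sequence_exact₁ M hS x (Ext.eq_zero_of_injective _) rfl
  have hker : LinearMap.range ((Ext.mk₀ S.g).postcompOfLinear R M (add_zero n)) =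
      LinearMap.ker δ := by
    ext x
    constructor
    · rintro ⟨y, rfl⟩
      change (y.comp (Ext.mk₀ S.g) (add_zero n)).comp hS.extClass rfl = 0
      rw [Ext.comp_assoc_of_second_deg_zero, hS.comp_extClass, Ext.comp_zero]
    · exact fun hx => Ext.covariant_sequence_exact₃ M hS x rfl hx
  exact ⟨(Submodule.quotEquivOfEq _ _ hker).trans (LinearMap.quotKerEquivOfSurjective δ hδ)⟩

theorem nonempty_quotient_equiv_ext_succ_of_projective {S : ShortComplex A}
    (hS : S.ShortExact) [Projective S.X₂] (M : A) (n : ℕ) :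
    Nonempty ((Ext S.X₁ M n ⧸ LinearMap.range
      ((Ext.mk₀ S.f).precompOfLinear R M (zero_add n))) ≃ₗ[R] Ext S.X₃ M (n + 1)) := by
  let δ : Ext S.X₁ M n →ₗ[R] Ext S.X₃ M (n + 1) := hS.extClass.precompOfLinear R M (add_comm 1 n)
  have hδ : Function.Surjective δ := fun x =>
    Ext.contravariant_sequence_exact₃ hS M x (Ext.eq_zero_of_projective _) (add_comm 1 n)
  have hker : LinearMap.range ((Ext.mk₀ S.f).precompOfLinear R M (zero_add n)) =
      LinearMap.ker δ := by
    ext x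
    constructor
    · rintro ⟨y, rfl⟩
      change hS.extClass.comp ((Ext.mk₀ S.f).comp y (zero_add n)) (add_comm 1 n) = 0
      rw [← Ext.comp_assoc_of_second_deg_zero, hS.extClass_comp, Ext.zero_comp]
    · exact fun hx => Ext.contravariant_sequence_exact₁ hS M x (add_comm 1 n) hx
  exact ⟨(Submodule.quotEquivOfEq _ _ hker).trans (LinearMap.quotKerEquivOfSurjective δ hδ)⟩

theorem nonempty_ext_equiv_of_injective {S : ShortComplex A}
    (hS : S.ShortExact) [Injective S.X₂] (M : A) (n : ℕ) :
    Nonempty (Ext M S.X₃ (n + 1) ≃ₗ[R] Ext M S.X₁ (n + 2)) := by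
  obtain ⟨e⟩ := nonempty_quotient_equiv_ext_succ_of_injective R hS M (n + 1)
  refine ⟨(Submodule.quotEquivOfEqBot _ ?_).symm.trans e⟩
  rw [Submodule.eq_bot_iff]
  rintro _ ⟨y, rfl⟩
  rw [Ext.eq_zero_of_injective y, map_zero]

theorem nonempty_ext_equiv_of_projective {S : ShortComplex A}
    (hS : S.ShortExact) [Projective S.X₂] (M : A) (n : ℕ) :
    Nonempty (Ext S.X₁ M (n + 1) ≃ₗ[R] Ext S.X₃ M (n + 2)) := by
  obtain ⟨e⟩ := nonempty_quotient_equiv_ext_succ_of_projective R hS M (n + 1)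
  refine ⟨(Submodule.quotEquivOfEqBot _ ?_).symm.trans e⟩
  rw [Submodule.eq_bot_iff]
  rintro _ ⟨y, rfl⟩
  rw [Ext.eq_zero_of_projective y, map_zero]

theorem nonempty_ext_one_equiv {B : Type t'} [Category.{v'} B] [Abelian B] [HasExt.{w'} B]
    [Linear R B] {S : ShortComplex A} (hS : S.ShortExact) [Injective S.X₂] {T : ShortComplex B}
    (hT : T.ShortExact) [Projective T.X₂] {M : A} {N : B} (e₂ : (M ⟶ S.X₂) ≃ₗ[R] (T.X₂ ⟶ N))
    (e₃ : (M ⟶ S.X₃) ≃ₗ[R] (T.X₁ ⟶ N)) (he : ∀ φ, e₃ (φ ≫ S.g) = T.f ≫ e₂ φ) :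
    Nonempty (Ext M S.X₁ 1 ≃ₗ[R] Ext T.X₃ N 1) := by
  obtain ⟨δ⟩ := nonempty_quotient_equiv_ext_succ_of_injective R hS M 0
  obtain ⟨δ'⟩ := nonempty_quotient_equiv_ext_succ_of_projective R hT N 0
  let E₂ : Ext M S.X₂ 0 ≃ₗ[R] Ext T.X₂ N 0 :=
    Ext.linearEquiv₀.trans (e₂.trans Ext.linearEquiv₀.symm)
  let E₃ : Ext M S.X₃ 0 ≃ₗ[R] Ext T.X₁ N 0 :=
    Ext.linearEquiv₀.trans (e₃.trans Ext.linearEquiv₀.symm)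
  have hE₂ (φ) : E₂ (Ext.mk₀ φ) = Ext.mk₀ (e₂ φ) := by
    simp only [E₂, LinearEquiv.trans_apply, ← Ext.linearEquiv₀_symm_apply (R := R),
      LinearEquiv.apply_symm_apply]
  have hE₃ (φ) : E₃ (Ext.mk₀ φ) = Ext.mk₀ (e₃ φ) := by
    simp only [E₃, LinearEquiv.trans_apply, ← Ext.linearEquiv₀_symm_apply (R := R),
      LinearEquiv.apply_symm_apply]
  have hcomm : E₃.toLinearMap ∘ₗ (Ext.mk₀ S.g).postcompOfLinear R M (add_zero 0) =
      (Ext.mk₀ T.f).precompOfLinear R N (zero_add 0) ∘ₗ E₂.toLinearMap := by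
    ext x
    obtain ⟨φ, rfl⟩ := Ext.addEquiv₀.symm.surjective x
    change E₃ ((Ext.mk₀ φ).comp (Ext.mk₀ S.g) (add_zero 0)) =
      (Ext.mk₀ T.f).comp (E₂ (Ext.mk₀ φ)) (zero_add 0)
    rw [Ext.mk₀_comp_mk₀, hE₂, hE₃, Ext.mk₀_comp_mk₀, he]
  refine ⟨δ.symm.trans ((Submodule.Quotient.equiv _ _ E₃ ?_).trans δ')⟩
  rw [← LinearMap.range_comp_of_range_eq_top _ (LinearEquiv.range E₂), ← hcomm,
    LinearMap.range_comp]

end DimensionShift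

namespace LeftComodule

variable {k C : Type u} [Field k] [AddCommGroup C] [Module k C] [Coalgebra k C]

section ExtDuality

open Abelian

attribute [local instance] rightDualModule

variable [IsArtinian (DualAlgebra k C)ᵐᵒᵖ C]

theorem nonempty_ext_equiv_dual (M : LeftComodule k C) (n : ℕ) (X : LeftComodule k C)
    [IsArtinian (DualAlgebra k C)ᵐᵒᵖ X.A] : Nonempty (Ext M X n ≃ₗ[k] Ext X.dual M.dual n) := by
  induction n generalizing X with
  | zero => exact ⟨(Ext.linearEquiv₀.trans (dualMapEquiv M X)).trans Ext.linearEquiv₀.symm⟩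
  | succ n ih =>
    obtain ⟨r, ι, _⟩ := X.exists_mono_cofree
    let S := ShortComplex.mk ι (cokernel.π ι) (cokernel.condition ι)
    have hS : S.ShortExact := { exact := ShortComplex.exact_cokernel ι }
    have hdual := shortExact_dualFunctor hS
    have : Injective S.X₂ := injective_cofree
    have : Projective (S.op.map (dualFunctor k C)).X₂ := projective_dual_cofree r
    have : IsArtinian (DualAlgebra k C)ᵐᵒᵖ S.X₂.A := isArtinian_cofree r
    have : IsArtinian (DualAlgebra k C)ᵐᵒᵖ S.X₃.A := isArtinian_of_epi (cokernel.π ι)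
    cases n with
    | zero =>
      exact nonempty_ext_one_equiv k hS hdual (dualMapEquiv M S.X₂) (dualMapEquiv M S.X₃) fun _ =>
        rfl
    | succ n =>
      obtain ⟨shift⟩ := nonempty_ext_equiv_of_injective k hS M n
      obtain ⟨shift'⟩ := nonempty_ext_equiv_of_projective k hdual M.dual n
      obtain ⟨e⟩ := ih S.X₃
      exact ⟨shift.symm.trans (e.trans shift')⟩

end ExtDuality

section QuasiFinite

variable {M : LeftComodule k C}

theorem isQuasiFinite_of_isArtinian [IsArtinian (DualAlgebra k C)ᵐᵒᵖ M.A] : M.IsQuasiFinite := by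
  intro K _
  obtain ⟨n, ι, _⟩ := M.exists_mono_cofree
  refine Module.Finite.of_injective (homCofreeEquiv.toLinearMap ∘ₗ Linear.rightComp k K ι) ?_
  exact homCofreeEquiv.injective.comp fun φ ψ h => (cancel_mono ι).1 h

attribute [local instance] rightDualModule

theorem op_smul_eq_zero_of_mem_socle {f : DualAlgebra k C}
    (hf : ∀ c ∈ socle (DualAlgebra k C)ᵐᵒᵖ C, MulOpposite.op f • c = 0) {m : M.A}
    (hm : m ∈ socle (DualAlgebra k C)ᵐᵒᵖ M.A) : MulOpposite.op f • m = 0 := by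
  refine (Module.forall_dual_apply_eq_zero_iff k _).1 fun χ => ?_
  let coeff : M ⟶ cofree k C (Fin 1 → k) := homCofreeEquiv.symm (LinearMap.pi fun _ => χ)
  let p : M.A →ₗ[(DualAlgebra k C)ᵐᵒᵖ] Fin 1 → C := (cofreeEquiv 1).toLinearMap ∘ₗ toLinear coeff
  have hp : p (MulOpposite.op f • m) = 0 := by
    ext i
    rw [map_smul, Pi.smul_apply]
    exact hf _ (map_socle_le (LinearMap.proj i ∘ₗ p) ⟨m, hm, rfl⟩)
  have hcoeff : coeff.f.hom (MulOpposite.op f • m) = 0 := (cofreeEquiv 1).map_eq_zero_iff.1 hp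
  have h := tensorCounit_homCofreeEquiv_symm (C := C) (LinearMap.pi fun _ : Fin 1 => χ)
    (MulOpposite.op f • m)
  exact congrFun (h.symm.trans ((congrArg _ hcoeff).trans (map_zero (tensorCounit k C _)))) 0

theorem exists_finiteDimensional_hom_apply_eq (E : LeftComodule k C) (z : E.A) :
    ∃ (K : LeftComodule k C) (w : K.A), FiniteDimensional k K.A ∧
      ∀ (M : LeftComodule k C) (m : M.A),
        (∀ f : (DualAlgebra k C)ᵐᵒᵖ, f • z = 0 → f • m = 0) → ∃ φ : K ⟶ M, φ.f.hom w = m := by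
  obtain ⟨K, ⟨e⟩⟩ := E.exists_subcomodule (Submodule.span (DualAlgebra k C)ᵐᵒᵖ {z})
  let q := Ideal.quotTorsionOfEquivSpanSingleton (DualAlgebra k C)ᵐᵒᵖ E.A z
  have hK : FiniteDimensional k K.A := by
    let e' : (Submodule.span (DualAlgebra k C)ᵐᵒᵖ {z}).restrictScalars k ≃ₗ[k] K.A :=
      e.symm.restrictScalars k
    have : FiniteDimensional k ((Submodule.span (DualAlgebra k C)ᵐᵒᵖ {z}).restrictScalars k) :=
      E.isLocallyFiniteModule z
    exact Module.Finite.equiv e'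
  refine ⟨K, e.symm (q (Submodule.Quotient.mk 1)), hK, fun M m h => ?_⟩
  let p := (Ideal.torsionOf (DualAlgebra k C)ᵐᵒᵖ E.A z).liftQ
    (LinearMap.toSpanSingleton (DualAlgebra k C)ᵐᵒᵖ M.A m) h
  refine ⟨ofLinear (p ∘ₗ q.symm.toLinearMap ∘ₗ e.toLinearMap), ?_⟩
  change p (q.symm (e (e.symm (q (Submodule.Quotient.mk 1))))) = m
  rw [e.apply_symm_apply, q.symm_apply_apply]
  exact one_smul (DualAlgebra k C)ᵐᵒᵖ m

-- A basis of the socle of `C`, as a vector in a finite power of `C`, has an annihilator which kills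
-- the socle of every comodule.
theorem exists_finiteDimensional_hom_apply_eq_of_mem_socle [IsArtinian (DualAlgebra k C)ᵐᵒᵖ C] :
    ∃ (K : LeftComodule k C) (w : K.A), FiniteDimensional k K.A ∧
      ∀ (M : LeftComodule k C), ∀ m ∈ socle (DualAlgebra k C)ᵐᵒᵖ M.A,
        ∃ φ : K ⟶ M, φ.f.hom w = m := by
  let D := (socle (DualAlgebra k C)ᵐᵒᵖ C).restrictScalars k
  have : FiniteDimensional k D := DualAlgebra.isLocallyFiniteModule.finiteDimensional_socle
  let b := Module.finBasis k D
  obtain ⟨K, w, hK, hw⟩ := exists_finiteDimensional_hom_apply_eq (cofree k C (Fin _ → k))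
    ((cofreeEquiv _).symm fun i => b i)
  refine ⟨K, w, hK, fun M m hm => hw M m fun f hf =>
    op_smul_eq_zero_of_mem_socle (f := f.unop) ?_ hm⟩
  have hb (i) : f • (b i : C) = 0 := by
    have h := congrArg (cofreeEquiv _) hf
    rw [map_smul, LinearEquiv.apply_symm_apply, map_zero] at h
    exact congrFun h i
  have hzero : Module.toModuleEnd k C f ∘ₗ D.subtype = 0 := b.ext hb
  exact fun c hc => LinearMap.congr_fun hzero ⟨c, hc⟩

theorem IsQuasiFinite.finiteDimensional_socle [IsArtinian (DualAlgebra k C)ᵐᵒᵖ C]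
    (hM : M.IsQuasiFinite) : FiniteDimensional k (socle (DualAlgebra k C)ᵐᵒᵖ M.A) := by
  obtain ⟨K, w, hK, hw⟩ := exists_finiteDimensional_hom_apply_eq_of_mem_socle (k := k) (C := C)
  have := hM K hK
  let evaluation : (K ⟶ M) →ₗ[k] M.A :=
    { toFun := fun φ => φ.f.hom w
      map_add' := fun _ _ => rfl
      map_smul' := fun _ _ => rfl }
  exact Submodule.finiteDimensional_of_le (S₂ := LinearMap.range evaluation)
    (S₁ := (socle (DualAlgebra k C)ᵐᵒᵖ M.A).restrictScalars k) (hw M)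

theorem IsQuasiFinite.isArtinian [IsArtinian (DualAlgebra k C)ᵐᵒᵖ C] (hM : M.IsQuasiFinite) :
    IsArtinian (DualAlgebra k C)ᵐᵒᵖ M.A := by
  have := hM.finiteDimensional_socle
  obtain ⟨n, ι, _⟩ := M.exists_mono_cofree_of_finiteDimensional_socle
  have := isArtinian_cofree (k := k) (C := C) n
  exact isArtinian_of_mono ι

end QuasiFinite

end LeftComodule

section SimpleModule

variable (R N : Type*) [Ring R] [AddCommGroup N] [Module R N]

theorem exists_retract_quotient_jacobson [IsSimpleModule R N]
    [IsArtinian R (R ⧸ Ring.jacobson R)] :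
    ∃ (s : N →ₗ[R] R ⧸ Ring.jacobson R) (r : (R ⧸ Ring.jacobson R) →ₗ[R] N),
      r ∘ₗ s = LinearMap.id := by
  have : IsSemisimpleModule R (R ⧸ Ring.jacobson R) :=
    (IsArtinian.isSemisimpleModule_iff_jacobson R _).2 (Module.jacobson_quotient_jacobson R R)
  have := IsSimpleModule.nontrivial R N
  obtain ⟨x, hx⟩ := exists_ne (0 : N)
  let r : (R ⧸ Ring.jacobson R) →ₗ[R] N :=
    (Ring.jacobson R).liftQ (LinearMap.toSpanSingleton R N x) fun _ ha =>
      Module.mem_annihilator.1 (IsSemisimpleModule.jacobson_le_annihilator R N ha) x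
  have hr : Function.Surjective r := fun y => by
    obtain ⟨a, rfl⟩ := IsSimpleModule.toSpanSingleton_surjective R hx y
    exact ⟨Submodule.Quotient.mk a, rfl⟩
  obtain ⟨s, hs⟩ := IsSemisimpleModule.lifting_property r hr LinearMap.id
  exact ⟨s, r, hs⟩

end SimpleModule

section ExtFinite

universe w v t

open Abelian

variable (k : Type*) [Field k] {A : Type t} [Category.{v} A] [Abelian A] [HasExt.{w} A]
  [Linear k A]

theorem finiteDimensional_ext_of_retract_left {X X' : A} (s : X ⟶ X') (r : X' ⟶ X)
    (h : s ≫ r = 𝟙 X) (Y : A) (n : ℕ) [FiniteDimensional k (Ext X' Y n)] :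
    FiniteDimensional k (Ext X Y n) := by
  refine Module.Finite.of_injective ((Ext.mk₀ r).precompOfLinear k Y (zero_add n)) ?_
  refine Function.LeftInverse.injective
    (g := (Ext.mk₀ s).precompOfLinear k Y (zero_add n)) fun x => ?_
  change (Ext.mk₀ s).comp ((Ext.mk₀ r).comp x (zero_add n)) (zero_add n) = x
  rw [Ext.mk₀_comp_mk₀_assoc, h, Ext.mk₀_id_comp]

theorem finiteDimensional_ext_of_retract_right {Y Y' : A} (s : Y ⟶ Y') (r : Y' ⟶ Y)
    (h : s ≫ r = 𝟙 Y) (X : A) (n : ℕ) [FiniteDimensional k (Ext X Y' n)] :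
    FiniteDimensional k (Ext X Y n) := by
  refine Module.Finite.of_injective ((Ext.mk₀ s).postcompOfLinear k X (add_zero n)) ?_
  refine Function.LeftInverse.injective
    (g := (Ext.mk₀ r).postcompOfLinear k X (add_zero n)) fun x => ?_
  change (x.comp (Ext.mk₀ s) (add_zero n)).comp (Ext.mk₀ r) (add_zero n) = x
  rw [Ext.comp_assoc_of_third_deg_zero, Ext.mk₀_comp_mk₀, h, Ext.comp_mk₀_id]

theorem finiteDimensional_ext_of_shortExact {S : ShortComplex A} (hS : S.ShortExact) (X : A)
    (n : ℕ) [FiniteDimensional k (Ext X S.X₁ n)] [FiniteDimensional k (Ext X S.X₃ n)] :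
    FiniteDimensional k (Ext X S.X₂ n) := by
  let ι : Ext X S.X₁ n →ₗ[k] Ext X S.X₂ n := (Ext.mk₀ S.f).postcompOfLinear k X (add_zero n)
  let π : Ext X S.X₂ n →ₗ[k] Ext X S.X₃ n := (Ext.mk₀ S.g).postcompOfLinear k X (add_zero n)
  suffices h : LinearMap.range ι = LinearMap.ker π from
    IsNoetherian.iff_fg.1 (isNoetherian_of_range_eq_ker ι π h)
  ext x
  constructor
  · rintro ⟨y, rfl⟩
    change (y.comp (Ext.mk₀ S.f) (add_zero n)).comp (Ext.mk₀ S.g) (add_zero n) = 0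
    rw [Ext.comp_assoc_of_third_deg_zero, Ext.mk₀_comp_mk₀, S.zero, Ext.mk₀_zero, Ext.comp_zero]
  · exact fun hx => Ext.covariant_sequence_exact₂ X hS x hx

end ExtFinite

namespace LeftComodule

variable {k C : Type u} [Field k] [AddCommGroup C] [Module k C] [Coalgebra k C]

open Abelian

section Simple

theorem isZero_of_subsingleton (T : LeftComodule k C) [Subsingleton T.A] : IsZero T :=
  (IsZero.iff_id_eq_zero T).2 (Comonad.Coalgebra.Hom.ext (ModuleCat.hom_ext
    (LinearMap.ext fun _ => Subsingleton.elim _ _)))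

theorem finrank_pos_of_not_isZero {T : LeftComodule k C} [FiniteDimensional k T.A]
    (hT : ¬ IsZero T) : 0 < Module.finrank k T.A := by
  by_contra! h
  have := Module.finrank_zero_iff.1 (Nat.le_zero.1 h)
  exact hT T.isZero_of_subsingleton

theorem finrank_add_finrank_of_shortExact {S : ShortComplex (LeftComodule k C)}
    (hS : S.ShortExact) [FiniteDimensional k S.X₂.A] :
    Module.finrank k S.X₁.A + Module.finrank k S.X₃.A = Module.finrank k S.X₂.A := by
  have hf := (mono_iff_injective S.f).1 hS.mono_f
  have hg := (epi_iff_surjective S.g).1 hS.epi_g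
  rw [← LinearMap.finrank_range_add_finrank_ker S.g.f.hom, LinearMap.range_eq_top.2 hg,
    finrank_top, LinearMap.exact_iff.1 (function_exact hS.exact),
    LinearMap.finrank_range_of_inj hf, add_comm]

theorem exists_shortExact_of_not_simple {T : LeftComodule k C} (hT : ¬ Simple T)
    (hT₀ : ¬ IsZero T) : ∃ S : ShortComplex (LeftComodule k C),
      S.ShortExact ∧ S.X₂ = T ∧ ¬ IsZero S.X₁ ∧ ¬ IsZero S.X₃ := by
  obtain ⟨Y, f, _, hf₀, hf⟩ :
      ∃ (Y : LeftComodule k C) (f : Y ⟶ T), Mono f ∧ f ≠ 0 ∧ ¬ IsIso f := by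
    by_contra! h
    refine hT ⟨fun {Y} f _ => ⟨fun hf h₀ => hT₀ ?_, h Y f inferInstance⟩⟩
    exact IsZero.of_epi_eq_zero f h₀
  refine ⟨.mk f (cokernel.π f) (cokernel.condition f),
    { exact := ShortComplex.exact_cokernel f }, rfl,
    fun hY => hf₀ (hY.eq_of_src _ _), fun hQ => hf ?_⟩
  have := Preadditive.epi_of_isZero_cokernel f hQ
  exact isIso_of_mono_of_epi f

end Simple

theorem SatisfiesChi.finiteDimensional_ext {M : LeftComodule k C} (hM : M.SatisfiesChi) (i : ℕ)
    (T : LeftComodule k C) [FiniteDimensional k T.A] : FiniteDimensional k (Ext M T i) := by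
  induction hd : Module.finrank k T.A using Nat.strong_induction_on generalizing T with
  | _ d ih =>
  by_cases hsimple : Simple T
  · exact hM T hsimple i
  by_cases hzero : IsZero T
  · have : Subsingleton (Ext M T i) := subsingleton_of_forall_eq 0 fun x => by
      rw [← Ext.comp_mk₀_id x, hzero.eq_of_src (𝟙 T) 0, Ext.mk₀_zero, Ext.comp_zero]
    infer_instance
  obtain ⟨S, hS, rfl, h₁, h₃⟩ := exists_shortExact_of_not_simple hsimple hzero
  have : FiniteDimensional k S.X₁.A :=
    .of_injective S.f.f.hom ((mono_iff_injective S.f).1 hS.mono_f)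
  have : FiniteDimensional k S.X₃.A :=
    .of_surjective S.g.f.hom ((epi_iff_surjective S.g).1 hS.epi_g)
  have hrank := finrank_add_finrank_of_shortExact hS
  have hpos₁ := finrank_pos_of_not_isZero h₁
  have hpos₃ := finrank_pos_of_not_isZero h₃
  have := ih _ (by omega) S.X₁ rfl
  have := ih _ (by omega) S.X₃ rfl
  exact finiteDimensional_ext_of_shortExact k hS M i

section Simple

variable (S : LeftComodule k C) [Simple S]

instance nontrivial_dual : Nontrivial S.dual := by
  by_contra h
  rw [not_nontrivial_iff_subsingleton] at h
  exact id_nonzero S (dualMap_injective (ModuleCat.hom_ext (LinearMap.ext fun _ =>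
    Subsingleton.elim _ _)))

attribute [local instance] rightDualModule

variable [IsArtinian (DualAlgebra k C)ᵐᵒᵖ C]

instance isArtinian_of_simple : IsArtinian (DualAlgebra k C)ᵐᵒᵖ S.A := by
  obtain ⟨χ, hχ⟩ := exists_ne (0 : Module.Dual k S.A)
  let coeff : S ⟶ cofree k C (Fin 1 → k) := homCofreeEquiv.symm (LinearMap.pi fun _ => χ)
  have hcoeff : coeff ≠ 0 := fun h => hχ (LinearMap.ext fun s =>
    congrFun (LinearMap.congr_fun (homCofreeEquiv.symm.map_eq_zero_iff.1 h) s) 0)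
  have := mono_of_nonzero_from_simple hcoeff
  have := isArtinian_cofree (k := k) (C := C) 1
  exact isArtinian_of_mono coeff

instance isSimpleModule_dual : IsSimpleModule (DualAlgebra k C) S.dual where
  exists_pair_ne := exists_pair_ne _
  eq_bot_or_eq_top P := by
    have := finite_dual (X := S)
    obtain ⟨T, _, ⟨e⟩⟩ := exists_artinian_dual_equiv (k := k) (C := C) (S.dual ⧸ P)
    let q : S.dual →ₗ[DualAlgebra k C] T.dual := e.symm.toLinearMap ∘ₗ P.mkQ
    have hq : Function.Surjective q := e.symm.surjective.comp P.mkQ_surjective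
    have hker : LinearMap.ker q = P := by
      rw [LinearMap.ker_comp, LinearEquiv.ker, Submodule.comap_bot, Submodule.ker_mkQ]
    obtain ⟨φ, hφ⟩ := dualMap_surjective (M := T) (X := S) (ModuleCat.ofHom q)
    have hsurj : Function.Surjective (dualMap φ).hom := by rwa [hφ]
    have : Mono φ := (mono_iff_injective φ).2 (LinearMap.dualMap_surjective_iff.1 hsurj)
    rcases eq_or_ne φ 0 with rfl | hne
    · right
      rw [← hker, LinearMap.ker_eq_top]
      exact (congrArg ModuleCat.Hom.hom hφ).symm.trans
        (congrArg ModuleCat.Hom.hom ((dualMapEquiv T S).map_zero))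
    · left
      have := isIso_of_mono_of_nonzero hne
      have hinj := injective_dualMap φ
      rw [← hker, LinearMap.ker_eq_bot]
      rwa [hφ] at hinj

end Simple

end LeftComodule

section Main

variable {k C : Type u} [Field k] [AddCommGroup C] [Module k C] [Coalgebra k C]

open Abelian LeftComodule

attribute [local instance] rightDualModule

theorem LeftComodule.finiteDimensional_of_dual_equiv {T : LeftComodule k C} {N : Type*}
    [AddCommGroup N] [Module k N] [Module (DualAlgebra k C) N]
    [IsScalarTower k (DualAlgebra k C) N] [FiniteDimensional k N]
    (e : T.dual ≃ₗ[DualAlgebra k C] N) : FiniteDimensional k T.A := by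
  have := isScalarTower_dual T
  exact (Module.finite_dual_iff k).1
    (Module.Finite.equiv (M := N) (N := Module.Dual k T.A) (e.symm.restrictScalars k))

theorem DualAlgebra.satisfiesLeftChi_of_coalgebra [IsArtinian (DualAlgebra k C)ᵐᵒᵖ C]
    (hC : Coalgebra.SatisfiesLeftChi k C) : Algebra.SatisfiesLeftChi k (DualAlgebra k C) := by
  intro N _ i
  have := DualAlgebra.finiteDimensional_quotient_jacobson (k := k) (C := C)
  obtain ⟨M, _, ⟨e⟩⟩ := exists_artinian_dual_equiv (k := k) (C := C) N
  obtain ⟨T, _, ⟨eT⟩⟩ := exists_artinian_dual_equiv (k := k) (C := C)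
    (DualAlgebra k C ⧸ Ring.jacobson (DualAlgebra k C))
  have := finiteDimensional_of_dual_equiv eT
  have := (hC M isQuasiFinite_of_isArtinian).finiteDimensional_ext i T
  obtain ⟨E⟩ := nonempty_ext_equiv_dual M i T
  have := Module.Finite.equiv E
  have := finiteDimensional_ext_of_retract_left k eT.toModuleIso.inv eT.toModuleIso.hom
    eT.toModuleIso.inv_hom_id M.dual i
  exact finiteDimensional_ext_of_retract_right k e.toModuleIso.inv e.toModuleIso.hom
    e.toModuleIso.inv_hom_id _ i

theorem DualAlgebra.coalgebra_satisfiesLeftChi [IsArtinian (DualAlgebra k C)ᵐᵒᵖ C]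
    (hA : Algebra.SatisfiesLeftChi k (DualAlgebra k C)) : Coalgebra.SatisfiesLeftChi k C := by
  intro M hM S _ i
  have := hM.isArtinian
  have := hA M.dual finite_dual i
  have := DualAlgebra.finiteDimensional_quotient_jacobson (k := k) (C := C)
  have : IsArtinian (DualAlgebra k C) (DualAlgebra k C ⧸ Ring.jacobson (DualAlgebra k C)) :=
    isArtinian_of_tower k inferInstance
  obtain ⟨s, r, hrs⟩ := exists_retract_quotient_jacobson (DualAlgebra k C) S.dual
  have := finiteDimensional_ext_of_retract_left k (ModuleCat.ofHom s) (ModuleCat.ofHom r)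
    (ModuleCat.hom_ext hrs) M.dual i
  obtain ⟨E⟩ := nonempty_ext_equiv_dual M i S
  exact Module.Finite.equiv E.symm

end Main

theorem mainTheorem8_general (k : Type u) [Field k] (C : Type u) [AddCommGroup C] [Module k C]
    [Coalgebra k C] (hC : IsArtinianCoalgebra k C) :
    (IsNoetherianRing (DualAlgebra k C) ∧ IsNoetherianRing (DualAlgebra k C)ᵐᵒᵖ ∧
      FiniteDimensional k (DualAlgebra k C ⧸ Ring.jacobson (DualAlgebra k C))) ∧
    (Coalgebra.SatisfiesLeftChi k C ↔ Algebra.SatisfiesLeftChi k (DualAlgebra k C)) := by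
  obtain ⟨_, _⟩ := hC
  exact ⟨⟨DualAlgebra.isNoetherianRing, DualAlgebra.isNoetherianRing_op,
    DualAlgebra.finiteDimensional_quotient_jacobson⟩,
    DualAlgebra.satisfiesLeftChi_of_coalgebra, DualAlgebra.coalgebra_satisfiesLeftChi⟩

theorem mainTheorem8 (k : Type u) [Field k] [IsAlgClosed k] [CharZero k]
    (C : Type u) [AddCommGroup C] [Module k C] [Coalgebra k C]
    (hC : IsArtinianCoalgebra k C) :
    (IsNoetherianRing (DualAlgebra k C) ∧ IsNoetherianRing (DualAlgebra k C)ᵐᵒᵖ ∧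
      FiniteDimensional k (DualAlgebra k C ⧸ Ring.jacobson (DualAlgebra k C))) ∧
    (Coalgebra.SatisfiesLeftChi k C ↔ Algebra.SatisfiesLeftChi k (DualAlgebra k C)) :=
  mainTheorem8_general k C hC
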